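/- \textbf{Setting.} Identify $\mathbb{P}^1=\mathbb{C}\cup\{\infty\}$. Let $\mathcal{W}$ be the Witt algebra, with basis $\{L_n\}_{n\in\mathbb{Z}}$ and bracket $[L_n,L_m]=(m-n)L_{n+m}$. For $X\in\{A,B\}$ and $\lambda\in\mathbb{P}^1$ let $X(\lambda)$ be the $\mathcal{W}$-module with basis $\{X_n\}_{n\in\mathbb{Z}}$ and action $L_n\cdot X_m=\omega_{X(\lambda)}(n,m)X_{n+m}$, where $$\omega_{A(\lambda)}(n,m)=n+m+n(n+1)\lambda\,\delta_m^0,\qquad \omega_{B(\lambda)}(n,m)=m-n(n+1)\lambda\,\delta_{n+m}^0,$$ with $n(n+1)\lambda$ replaced by $n^2$ if $\lambda=\infty$. Let $\mathcal{W}_X(\lambda)=\mathcal{W}\ltimes X(\lambda)$ be the semidirect sum, in which $X(\lambda)$ is an abelian ideal. For a complex Lie algebra $\mathfrak{g}$, let $\mathrm{InnAut}(\mathfrak{g})\le\mathrm{Aut}(\mathfrak{g})$ be the subgroup generated by all $\exp(\mathrm{ad}_x)$ with $\mathrm{ad}_x$ locally nilpotent. For $\alpha,\xi\in\mathbb{C}^\times$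 and $a,b\in\mathbb{C}$ define automorphisms of $\mathcal{W}_X(\lambda)$ as follows. \begin{itemize} \item $\sigma_\alpha(L_n)=\alpha^nL_n$, $\sigma_\alpha(X_n)=\alpha^nX_n$; $\quad\mu_\xi(L_n)=L_n$, $\mu_\xi(X_n)=\xi X_n$. \item For $\lambda\in\{0,-1\}$: $\tau_\lambda(L_n)=-L_{-n}$ and $\tau_\lambda(X_n)=X_{-n}$, except that $\tau_{-1}(X_0)=-X_0$. For $\lambda\notin\{0,-1\}$: $\tau_\lambda=\mathrm{id}$. \item $\varphi_a$ and $\psi_b$ fix every $X_n$. If $X=A$, then $\varphi_a(L_n)=L_n+an^2A_n$ and $\psi_b(L_n)=L_n+bnA_n$. If $X=B$, then $\varphi_a(L_n)=L_n+aB_n$, except that $\varphi_a(L_0)=L_0+(\lambda+1)aB_0$ when $\lambda\ne\infty$; moreover $\psi_b(L_n)=L_n+bnB_n$ if $\lambda=0$, and $\psi_b=\mathrm{id}$ if $\lambda\neq0$. \end{itemize} On $\mathcal{W}_A(\lambda)$ put $\varpi_a=\varphi_a$ if $\lambda=0$ and $\varpi_a=\psi_a$ if $\lambda\ne0$. For $k\in\mathbb{Z}/2\mathbb{Z}$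 put $$\Psi^{A(\lambda)}_{k;a;\alpha,\xi}=\tau_\lambda^k\varpi_a\sigma_\alpha\mu_\xi,\qquad \Phi^{B(\lambda)}_{k;a,b;\alpha,\xi}=\tau_\lambda^k\varphi_a\psi_b\sigma_\alpha\mu_\xi,$$ and let $G_A(\lambda)$ be the set of all $\Psi^{A(\lambda)}_{k;a;\alpha,\xi}$ and $G_B(\lambda)$ the set of all $\Phi^{B(\lambda)}_{k;a,b;\alpha,\xi}$. Let $\mathbb{C}^\infty$ be the additive group of finitely supported sequences $(z_i)_{i\in\mathbb{Z}}$ in $\mathbb{C}$, and $\mathbb{C}_0^\infty=\{z\in\mathbb{C}^\infty\mid z_0=0\}$. \textbf{Theorem.} Let $X\in\{A,B\}$ and $\lambda\in\mathbb{P}^1$. Then $G_X(\lambda)$ is a subgroup of $\mathrm{Aut}(\mathcal{W}_X(\lambda))$, and $$\mathrm{Aut}(\mathcal{W}_X(\lambda))=\mathrm{InnAut}(\mathcal{W}_X(\lambda))\rtimes G_X(\lambda),$$ that is, $\mathrm{InnAut}(\mathcal{W}_X(\lambda))$ is normal and every automorphism is uniquely a product of an inner one and an element of $G_X(\lambda)$.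 Consequently, $$\mathrm{Aut}(\mathcal{W}_X(\lambda))\cong\begin{cases} \mathbb{C}^\infty\rtimes(\mathbb{Z}/2\mathbb{Z}\ltimes(\mathbb{C}\rtimes(\mathbb{C}^\times\times\mathbb{C}^\times))),& X=A,\ \lambda\in\{0,-1\},\\ \mathbb{C}^\infty_0\rtimes(\mathbb{Z}/2\mathbb{Z}\ltimes(\mathbb{C}^2\rtimes(\mathbb{C}^\times\times\mathbb{C}^\times))),& X=B,\ \lambda=0,\\ \mathbb{C}^\infty_0\rtimes(\mathbb{Z}/2\mathbb{Z}\ltimes(\mathbb{C}\rtimes(\mathbb{C}^\times\times\mathbb{C}^\times))),& X=B,\ \lambda=-1,\\ \mathbb{C}^\infty\rtimes(\mathbb{C}\rtimes(\mathbb{C}^\times\times\mathbb{C}^\times)),& X=A,\ \lambda\notin\{0,-1\},\\ \mathbb{C}^\infty_0\rtimes(\mathbb{C}\rtimes(\mathbb{C}^\times\times\mathbb{C}^\times)),& X=B,\ \lambda\notin\{0,-1\}. \end{cases}$$ The isomorphism can be chosen so that it sends $\mathrm{InnAut}(\mathcal{W}_X(\lambda))$ onto the factor $\mathbb{C}^\infty$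 (if $X=A$) or $\mathbb{C}_0^\infty$ (if $X=B$), and so that the following automorphism corresponds to the tuple on its right, where $y_0=0$ if $X=B$: \begin{align*} \mathcal{W}_A(\lambda),\ \lambda\in\{0,-1\}&:\ \exp\big(\mathrm{ad}_{\sum_iy_iA_i}\big)\,\Psi^{A(\lambda)}_{k;a;\alpha,\xi}\ \leftrightarrow\ ((y_i),k,a,\alpha,\xi);\\ \mathcal{W}_B(0)&:\ \exp\big(\mathrm{ad}_{\sum_iy_iB_i}\big)\,\Phi^{B(0)}_{k;a,b;\alpha,\xi}\ \leftrightarrow\ ((y_i),k,a,b,\alpha,\xi);\\ \mathcal{W}_B(-1)&:\ \exp\big(\mathrm{ad}_{\sum_iy_iB_i}\big)\,\Phi^{B(-1)}_{k;a,0;\alpha,\xi}\ \leftrightarrow\ ((y_i),k,a,\alpha,\xi);\\ \mathcal{W}_A(\lambda),\ \lambda\notin\{0,-1\}&:\ \exp\big(\mathrm{ad}_{\sum_iy_iA_i}\big)\,\Psi^{A(\lambda)}_{0;a;\alpha,\xi}\ \leftrightarrow\ ((y_i),a,\alpha,\xi);\\ \mathcal{W}_B(\lambda),\ \lambda\notin\{0,-1\}&:\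 \exp\big(\mathrm{ad}_{\sum_iy_iB_i}\big)\,\Phi^{B(\lambda)}_{0;a,0;\alpha,\xi}\ \leftrightarrow\ ((y_i),a,\alpha,\xi). \end{align*} With $\varepsilon_1=(-1)^k$ and $\varepsilon_2=(-1)^\ell$, and with $y_0=z_0=0$ if $X=B$, the multiplication in these coordinates is \begin{align*} \mathcal{W}_B(0)&:\ ((y_i),k,a,b,\alpha,\xi)\cdot((z_i),\ell,c,d,\beta,\zeta)=((y_i+\alpha^{\varepsilon_1i}\xi z_{\varepsilon_1i}),\,k+\ell,\,\varepsilon_2a+\xi c,\,b+\xi d,\,\alpha^{\varepsilon_2}\beta,\,\xi\zeta);\\ \mathcal{W}_A(0),\mathcal{W}_B(-1)&:\ ((y_i),k,a,\alpha,\xi)\cdot((z_i),\ell,c,\beta,\zeta)=((y_i+\alpha^{\varepsilon_1i}\xi z_{\varepsilon_1i}),\,k+\ell,\,\varepsilon_2a+\xi c,\,\alpha^{\varepsilon_2}\beta,\,\xi\zeta);\\ \mathcal{W}_A(-1)&:\ ((y_i),k,b,\alpha,\xi)\cdot((z_i),\ell,d,\beta,\zeta)=((y_i+\varepsilon_1^{\delta_i^0}\alpha^{\varepsilon_1i}\xi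 z_{\varepsilon_1i}),\,k+\ell,\,b+\xi d,\,\alpha^{\varepsilon_2}\beta,\,\xi\zeta);\\ \mathcal{W}_X(\lambda),\ \lambda\notin\{0,-1\}&:\ ((y_i),a,\alpha,\xi)\cdot((z_i),c,\beta,\zeta)=((y_i+\alpha^i\xi z_i),\,a+\xi c,\,\alpha\beta,\,\xi\zeta). \end{align*} -/

import Mathlib

open scoped OnePoint

noncomputable section

namespace LieAut

/-- The group `Aut(𝔤)` of automorphisms of a Lie algebra, under composition. -/
instance instGroup {R L : Type*} [CommRing R] [LieRing L] [LieAlgebra R L] :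
    Group (L ≃ₗ⁅R⁆ L) where
  one := 1
  mul f g := g.trans f
  inv f := f.symm
  mul_assoc _ _ _ := rfl
  one_mul _ := rfl
  mul_one _ := rfl
  inv_mul_cancel f := by
    ext x
    exact f.symm_apply_apply x

theorem mul_apply {R L : Type*} [CommRing R] [LieRing L] [LieAlgebra R L]
    (f g : L ≃ₗ⁅R⁆ L) (x : L) : (f * g) x = f (g x) := rfl

variable {L : Type*} [LieRing L] [LieAlgebra ℂ L]

/-- `ad x` is locally nilpotent. -/
def IsLocNilp (x : L) : Prop :=
  ∀ y : L, ∃ n : ℕ, ((LieAlgebra.ad ℂ L x) ^ n) y = 0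

/-- The automorphism `σ` is `exp(ad x) = ∑ (ad x)^n / n!`, where `ad x` is locally nilpotent (so
that the sum is finite at every vector). -/
def IsExpAd (x : L) (σ : L ≃ₗ⁅ℂ⁆ L) : Prop :=
  IsLocNilp x ∧
    ∀ y : L, σ y = ∑ᶠ n : ℕ, ((n.factorial : ℂ)⁻¹) • ((LieAlgebra.ad ℂ L x) ^ n) y

variable (L) in
/-- The group of inner automorphisms, generated by all `exp(ad x)` with `ad x` locally
nilpotent. -/
def innAut : Subgroup (L ≃ₗ⁅ℂ⁆ L) :=
  Subgroup.closure {σ | ∃ x : L, IsExpAd x σ}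

end LieAut

namespace WittSum

/-- The bilinear extension of `(e_n, e_m) ↦ c(n, m) e_{n+m}`. -/
def gradedMul (c : ℤ → ℤ → ℂ) : (ℤ →₀ ℂ) →ₗ[ℂ] (ℤ →₀ ℂ) →ₗ[ℂ] (ℤ →₀ ℂ) :=
  Finsupp.linearCombination ℂ fun n =>
    Finsupp.linearCombination ℂ fun m => Finsupp.single (n + m) (c n m)

theorem gradedMul_single (c : ℤ → ℤ → ℂ) (n m : ℤ) (a b : ℂ) :
    gradedMul c (Finsupp.single n a) (Finsupp.single m b) =
      Finsupp.single (n + m) (a * (b * c n m)) := by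
  rw [gradedMul, Finsupp.linearCombination_single, LinearMap.smul_apply,
    Finsupp.linearCombination_single, Finsupp.smul_single, Finsupp.smul_single, smul_eq_mul,
    smul_eq_mul]

theorem gradedMul_jacobi (c d : ℤ → ℤ → ℂ)
    (h : ∀ n m k, d m k * d n (m + k) = c n m * d (n + m) k + d n k * d m (n + k))
    (x y z : ℤ →₀ ℂ) :
    gradedMul d x (gradedMul d y z) =
      gradedMul d (gradedMul c x y) z + gradedMul d y (gradedMul d x z) := by
  induction x using Finsupp.induction_linear with
  | zero => simp
  | add x x' hx hx' => simp only [map_add, LinearMap.add_apply, hx, hx']; abel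
  | single n a =>
    induction y using Finsupp.induction_linear with
    | zero => simp
    | add y y' hy hy' => simp only [map_add, LinearMap.add_apply, hy, hy']; abel
    | single m b =>
      induction z using Finsupp.induction_linear with
      | zero => simp
      | add z z' hz hz' => simp only [map_add, hz, hz']; abel
      | single k e =>
        simp only [gradedMul_single]
        rw [show m + (n + k) = n + (m + k) by ring, show n + m + k = n + (m + k) by ring,
          ← Finsupp.single_add]
        congr 1
        linear_combination a * b * e * h n m k

theorem gradedMul_self (c : ℤ → ℤ → ℂ) (h : ∀ n m, c m n = -c n m) (x : ℤ →₀ ℂ) :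
    gradedMul c x x = 0 := by
  have skew : ∀ x y, gradedMul c y x = -gradedMul c x y := by
    intro x y
    induction x using Finsupp.induction_linear with
    | zero => simp
    | add x x' hx hx' => simp only [map_add, LinearMap.add_apply, hx, hx']; abel
    | single n a =>
      induction y using Finsupp.induction_linear with
      | zero => simp
      | add y y' hy hy' => simp only [map_add, LinearMap.add_apply, hy, hy']; abel
      | single m b =>
        simp only [gradedMul_single]
        rw [add_comm m n, ← Finsupp.single_neg, h n m]
        congr 1
        ring
  have h2 : (2 : ℂ) • gradedMul c x x = 0 := by
    rw [two_smul]
    nth_rewrite 1 [skew x x]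
    simp
  simpa using h2

/-- The Witt algebra: it has the basis `L_n = single n 1`, with `[L_n, L_m] = (m - n) L_{n+m}`. -/
def Witt : Type := ℤ →₀ ℂ

instance : AddCommGroup Witt := inferInstanceAs (AddCommGroup (ℤ →₀ ℂ))
instance : Module ℂ Witt := inferInstanceAs (Module ℂ (ℤ →₀ ℂ))

/-- The basis element `L_n`. -/
def wittBasis (n : ℤ) : Witt := (Finsupp.single n 1 : ℤ →₀ ℂ)

def wittCoeff (n m : ℤ) : ℂ := (m : ℂ) - n

instance : LieRing Witt where
  bracket x y := gradedMul wittCoeff x y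
  add_lie x y z := LinearMap.congr_fun (map_add (gradedMul wittCoeff) x y) z
  lie_add x y z := map_add (gradedMul wittCoeff x) y z
  lie_self x := gradedMul_self _ (fun n m => by simp [wittCoeff]) x
  leibniz_lie x y z :=
    gradedMul_jacobi _ _ (fun n m k => by simp only [wittCoeff]; push_cast; ring) x y z

instance : LieAlgebra ℂ Witt where
  lie_smul t x y := map_smul (gradedMul wittCoeff x) t y

theorem wittBasis_lie (n m : ℤ) :
    ⁅wittBasis n, wittBasis m⁆ = ((m : ℂ) - n) • wittBasis (n + m) := by
  refine (gradedMul_single wittCoeff n m 1 1).trans ?_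
  rw [one_mul, one_mul]
  exact (Finsupp.smul_single_one _ _).symm

/-- The two families `A(λ)` and `B(λ)`. -/
inductive Kind
  | A
  | B

/-- `n(n+1)λ` for finite `λ`, and `n²` for `λ = ∞`. -/
def defect (lam : OnePoint ℂ) (n : ℤ) : ℂ :=
  lam.elim ((n : ℂ) ^ 2) fun l => (n : ℂ) * (n + 1) * l

/-- The structure constants `ω(n, m)` in `L_n · X_m = ω(n, m) X_{n+m}`. -/
def omega : Kind → OnePoint ℂ → ℤ → ℤ → ℂ
  | .A, lam, n, m => (n : ℂ) + m + if m = 0 then defect lam n else 0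
  | .B, lam, n, m => (m : ℂ) - if n + m = 0 then defect lam n else 0

theorem defect_zero (lam : OnePoint ℂ) : defect lam 0 = 0 := by
  induction lam using OnePoint.rec <;> simp [defect]

theorem defect_add (lam : OnePoint ℂ) (n m : ℤ) :
    ((n : ℂ) + m) * (defect lam m - defect lam n) = ((m : ℂ) - n) * defect lam (n + m) := by
  induction lam using OnePoint.rec <;> simp [defect] <;> ring

theorem omega_rep (X : Kind) (lam : OnePoint ℂ) (n m k : ℤ) :
    omega X lam m k * omega X lam n (m + k) =
      wittCoeff n m * omega X lam (n + m) k + omega X lam n k * omega X lam m (n + k) := by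
  cases X with
  | A =>
    have h0 := defect_zero lam
    have h1 := defect_add lam n m
    simp only [omega, wittCoeff]
    rcases eq_or_ne k 0 with rfl | hk
    · rcases eq_or_ne m 0 with rfl | hm
      · rcases eq_or_ne n 0 with rfl | hn
        · simp
        · simp [hn, h0]; ring
      · rcases eq_or_ne n 0 with rfl | hn
        · simp [hm, h0]; ring
        · simp [hn, hm]; linear_combination h1
    · have e1 : ((m : ℂ) + k) * (if m + k = 0 then defect lam n else 0) = 0 := by
        split_ifs with h
        · rw [show (m : ℂ) + k = 0 by exact_mod_cast h, zero_mul]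
        · simp
      have e2 : ((n : ℂ) + k) * (if n + k = 0 then defect lam m else 0) = 0 := by
        split_ifs with h
        · rw [show (n : ℂ) + k = 0 by exact_mod_cast h, zero_mul]
        · simp
      simp only [hk, if_false]
      push_cast
      linear_combination e1 - e2
  | B =>
    simp only [omega, wittCoeff]
    by_cases hs : n + m + k = 0
    · obtain rfl : k = -(n + m) := by omega
      have h1 := defect_add lam n m
      have a1 : (m : ℤ) + -(n + m) = -n := by ring
      have a2 : (n : ℤ) + -(n + m) = -m := by ring
      simp only [a1, a2, add_neg_cancel, if_true, neg_eq_zero]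
      rcases eq_or_ne n 0 with rfl | hn
      · rcases eq_or_ne m 0 with rfl | hm
        · simp
        · simp [hm, defect_zero]
      · rcases eq_or_ne m 0 with rfl | hm
        · simp [hn, defect_zero]
        · simp [hn, hm]; linear_combination -h1
    · have e1 : ¬ (n + (m + k) = 0) := by omega
      have e2 : ¬ (m + (n + k) = 0) := by omega
      simp only [hs, e1, e2, if_false]
      have e3 : ((m : ℂ) + k) * (if m + k = 0 then defect lam m else 0) = 0 := by
        split_ifs with h
        · rw [show (m : ℂ) + k = 0 by exact_mod_cast h, zero_mul]
        · simp
      have e4 : ((n : ℂ) + k) * (if n + k = 0 then defect lam n else 0) = 0 := by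
        split_ifs with h
        · rw [show (n : ℂ) + k = 0 by exact_mod_cast h, zero_mul]
        · simp
      push_cast
      linear_combination -e3 + e4

/-- The intermediate series module `X(λ)` with basis `X_n = single n 1`, regarded as an abelian
Lie algebra. -/
def SeriesModule (_X : Kind) (_lam : OnePoint ℂ) : Type := ℤ →₀ ℂ

section
variable (X : Kind) (lam : OnePoint ℂ)

instance : AddCommGroup (SeriesModule X lam) := inferInstanceAs (AddCommGroup (ℤ →₀ ℂ))
instance : Module ℂ (SeriesModule X lam) := inferInstanceAs (Module ℂ (ℤ →₀ ℂ))

instance : LieRing (SeriesModule X lam) where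
  bracket _ _ := 0
  add_lie _ _ _ := (add_zero _).symm
  lie_add _ _ _ := (add_zero _).symm
  lie_self _ := rfl
  leibniz_lie _ _ _ := (add_zero _).symm

instance : LieAlgebra ℂ (SeriesModule X lam) where
  lie_smul t _ _ := (smul_zero t).symm

/-- The action of the Witt algebra on `X(λ)`, `L_n · X_m = ω(n, m) X_{n+m}`, by derivations of the
abelian Lie algebra `X(λ)`. -/
def action : Witt →ₗ⁅ℂ⁆ LieDerivation ℂ (SeriesModule X lam) (SeriesModule X lam) where
  toFun x :=
    { toLinearMap := (gradedMul (omega X lam) x : (ℤ →₀ ℂ) →ₗ[ℂ] (ℤ →₀ ℂ))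
      leibniz' := fun a b => by
        change gradedMul (omega X lam) x (0 : ℤ →₀ ℂ) = (0 : ℤ →₀ ℂ) - 0
        simp }
  map_add' x y := by
    ext v : 1
    exact LinearMap.congr_fun (map_add (gradedMul (omega X lam)) x y) v
  map_smul' t x := by
    ext v : 1
    exact LinearMap.congr_fun (map_smul (gradedMul (omega X lam)) t x) v
  map_lie' {x y} := by
    ext v : 1
    change gradedMul (omega X lam) (gradedMul wittCoeff x y) v =
      gradedMul (omega X lam) x (gradedMul (omega X lam) y v) -
        gradedMul (omega X lam) y (gradedMul (omega X lam) x v)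
    rw [gradedMul_jacobi wittCoeff (omega X lam) (omega_rep X lam) x y v]
    abel

/-- The basis element `X_n`. -/
def seriesBasis (n : ℤ) : SeriesModule X lam := (Finsupp.single n 1 : ℤ →₀ ℂ)

theorem action_basis (n m : ℤ) :
    action X lam (wittBasis n) (seriesBasis X lam m) =
      omega X lam n m • seriesBasis X lam (n + m) := by
  refine (gradedMul_single (omega X lam) n m 1 1).trans ?_
  rw [one_mul, one_mul]
  exact (Finsupp.smul_single_one _ _).symm

theorem series_lie (u v : SeriesModule X lam) : ⁅u, v⁆ = 0 := rfl

/-- The Lie algebra `𝒲_X(λ) = 𝒲 ⋉ X(λ)`. -/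
abbrev WX : Type := LieAlgebra.SemiDirectSum (SeriesModule X lam) Witt (action X lam)

/-- The basis element `L_n` of `𝒲_X(λ)`. -/
def vL (n : ℤ) : WX X lam := ⟨0, wittBasis n⟩

/-- The basis element `X_n` of `𝒲_X(λ)`. -/
def vX (n : ℤ) : WX X lam := ⟨seriesBasis X lam n, 0⟩

variable {X lam}

@[elab_as_elim]
theorem wx_induction {p : WX X lam → Prop} (x : WX X lam) (zero : p 0)
    (add : ∀ x y, p x → p y → p (x + y)) (smul : ∀ (c : ℂ) x, p x → p (c • x))
    (hL : ∀ n, p (vL X lam n)) (hX : ∀ n, p (vX X lam n)) : p x := by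
  obtain ⟨u, v⟩ := x
  have hu : ∀ u : ℤ →₀ ℂ, p ⟨u, 0⟩ := by
    intro u
    induction u using Finsupp.induction_linear with
    | zero => exact zero
    | add a b ha hb =>
      have := add _ _ ha hb
      rwa [LieAlgebra.SemiDirectSum.add_eq_mk, add_zero] at this
    | single n a =>
      have := smul a _ (hX n)
      rw [vX, LieAlgebra.SemiDirectSum.smul_eq_mk, smul_zero] at this
      have e : (a • (Finsupp.single n 1 : ℤ →₀ ℂ)) = Finsupp.single n a := by simp
      exact e ▸ this
  have hv : ∀ v : ℤ →₀ ℂ, p ⟨0, v⟩ := by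
    intro v
    induction v using Finsupp.induction_linear with
    | zero => exact zero
    | add a b ha hb =>
      have := add _ _ ha hb
      rwa [LieAlgebra.SemiDirectSum.add_eq_mk, add_zero] at this
    | single n a =>
      have := smul a _ (hL n)
      rw [vL, LieAlgebra.SemiDirectSum.smul_eq_mk, smul_zero] at this
      have e : (a • (Finsupp.single n 1 : ℤ →₀ ℂ)) = Finsupp.single n a := by simp
      exact e ▸ this
  have := add _ _ (hu u) (hv v)
  rwa [LieAlgebra.SemiDirectSum.add_eq_mk, add_zero, zero_add] at this

theorem lie_vL_vL (n m : ℤ) :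
    ⁅vL X lam n, vL X lam m⁆ = ((m : ℂ) - n) • vL X lam (n + m) := by
  rw [LieAlgebra.SemiDirectSum.lie_eq_mk, vL, vL, vL, LieAlgebra.SemiDirectSum.smul_eq_mk,
    wittBasis_lie]
  simp only [map_zero, lie_zero, smul_zero, sub_zero, add_zero]

theorem lie_vL_vX (n m : ℤ) :
    ⁅vL X lam n, vX X lam m⁆ = omega X lam n m • vX X lam (n + m) := by
  rw [LieAlgebra.SemiDirectSum.lie_eq_mk, vL, vX, vX, LieAlgebra.SemiDirectSum.smul_eq_mk,
    action_basis]
  simp only [map_zero, lie_zero, zero_lie, smul_zero, sub_zero, zero_add]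

theorem lie_vX_vL (n m : ℤ) :
    ⁅vX X lam n, vL X lam m⁆ = -(omega X lam m n • vX X lam (n + m)) := by
  rw [← lie_skew, lie_vL_vX, add_comm]

theorem lie_vX_vX (n m : ℤ) : ⁅vX X lam n, vX X lam m⁆ = 0 := by
  rw [LieAlgebra.SemiDirectSum.lie_eq_mk, vX, vX, LieAlgebra.SemiDirectSum.zero_eq_mk, series_lie]
  simp only [map_zero, lie_zero, LieDerivation.zero_apply, sub_zero, add_zero]

/-- The linear endomorphism with `L_n ↦ f n` and `X_n ↦ g n`. -/
def linMap (f g : ℤ → WX X lam) : WX X lam →ₗ[ℂ] WX X lam where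
  toFun x := Finsupp.linearCombination ℂ f x.right + Finsupp.linearCombination ℂ g x.left
  map_add' x y := by
    have h1 := map_add (Finsupp.linearCombination ℂ f) x.right y.right
    have h2 := map_add (Finsupp.linearCombination ℂ g) x.left y.left
    refine (congrArg₂ (· + ·) h1 h2).trans ?_
    exact add_add_add_comm _ _ _ _
  map_smul' t x := by
    have h1 := map_smul (Finsupp.linearCombination ℂ f) t x.right
    have h2 := map_smul (Finsupp.linearCombination ℂ g) t x.left
    refine (congrArg₂ (· + ·) h1 h2).trans ?_
    exact (smul_add _ _ _).symm

theorem linMap_vL (f g : ℤ → WX X lam) (n : ℤ) : linMap f g (vL X lam n) = f n := by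
  have h1 := Finsupp.linearCombination_single ℂ (1 : ℂ) n (v := f)
  have h2 := map_zero (Finsupp.linearCombination ℂ g)
  refine (congrArg₂ (· + ·) h1 h2).trans ?_
  simp

theorem linMap_vX (f g : ℤ → WX X lam) (n : ℤ) : linMap f g (vX X lam n) = g n := by
  have h1 := Finsupp.linearCombination_single ℂ (1 : ℂ) n (v := g)
  have h2 := map_zero (Finsupp.linearCombination ℂ f)
  refine (congrArg₂ (· + ·) h2 h1).trans ?_
  simp

/-- The automorphism with `L_n ↦ f n` and `X_n ↦ g n`, and with inverse `L_n ↦ f' n` and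
`X_n ↦ g' n`. -/
def mkAut (f g f' g' : ℤ → WX X lam)
    (hLL : ∀ n m, ⁅f n, f m⁆ = ((m : ℂ) - n) • f (n + m))
    (hLX : ∀ n m, ⁅f n, g m⁆ = omega X lam n m • g (n + m))
    (hXX : ∀ n m, ⁅g n, g m⁆ = 0)
    (h1 : ∀ n, linMap f g (f' n) = vL X lam n) (h2 : ∀ n, linMap f g (g' n) = vX X lam n)
    (h3 : ∀ n, linMap f' g' (f n) = vL X lam n) (h4 : ∀ n, linMap f' g' (g n) = vX X lam n) :
    WX X lam ≃ₗ⁅ℂ⁆ WX X lam where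
  __ := linMap f g
  map_lie' {x y} := by
    change linMap f g ⁅x, y⁆ = ⁅linMap f g x, linMap f g y⁆
    induction x using wx_induction with
    | zero => simp only [zero_lie, map_zero]
    | add x x' hx hx' => simp only [add_lie, map_add, hx, hx']
    | smul c x hx => simp only [smul_lie, map_smul, hx]
    | hL n =>
      induction y using wx_induction with
      | zero => simp only [lie_zero, map_zero]
      | add y y' hy hy' => simp only [lie_add, map_add, hy, hy']
      | smul c y hy => simp only [lie_smul, map_smul, hy]
      | hL m => simp only [lie_vL_vL, map_smul, linMap_vL, hLL]
      | hX m => simp only [lie_vL_vX, map_smul, linMap_vL, linMap_vX, hLX]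
    | hX n =>
      induction y using wx_induction with
      | zero => simp only [lie_zero, map_zero]
      | add y y' hy hy' => simp only [lie_add, map_add, hy, hy']
      | smul c y hy => simp only [lie_smul, map_smul, hy]
      | hL m =>
        simp only [lie_vX_vL, map_neg, map_smul, linMap_vL, linMap_vX]
        rw [← lie_skew, hLX, add_comm]
      | hX m => simp only [lie_vX_vX, map_zero, linMap_vX, hXX]
  invFun := linMap f' g'
  left_inv x := by
    change linMap f' g' (linMap f g x) = x
    induction x using wx_induction with
    | zero => simp only [map_zero]
    | add x x' hx hx' => simp only [map_add, hx, hx']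
    | smul c x hx => simp only [map_smul, hx]
    | hL n => rw [linMap_vL, h3]
    | hX n => rw [linMap_vX, h4]
  right_inv x := by
    change linMap f g (linMap f' g' x) = x
    induction x using wx_induction with
    | zero => simp only [map_zero]
    | add x x' hx hx' => simp only [map_add, hx, hx']
    | smul c x hx => simp only [map_smul, hx]
    | hL n => rw [linMap_vL, h1]
    | hX n => rw [linMap_vX, h2]

variable (X lam)

/-- The group `Aut(𝒲_X(λ))`. -/
abbrev AutWX : Type := WX X lam ≃ₗ⁅ℂ⁆ WX X lam

theorem zpow_mul_zpow_smul (α : ℂˣ) (n m : ℤ) :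
    ((α ^ n : ℂˣ) : ℂ) * ((α ^ m : ℂˣ) : ℂ) = ((α ^ (n + m) : ℂˣ) : ℂ) := by
  rw [zpow_add, Units.val_mul]

/-- `σ_α : L_n ↦ α^n L_n, X_n ↦ α^n X_n`. -/
def sigmaAut (α : ℂˣ) : AutWX X lam :=
  mkAut (fun n => ((α ^ n : ℂˣ) : ℂ) • vL X lam n) (fun n => ((α ^ n : ℂˣ) : ℂ) • vX X lam n)
    (fun n => ((α⁻¹ ^ n : ℂˣ) : ℂ) • vL X lam n) (fun n => ((α⁻¹ ^ n : ℂˣ) : ℂ) • vX X lam n)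
    (fun n m => by
      simp only [smul_lie, lie_smul, lie_vL_vL, smul_smul, ← zpow_mul_zpow_smul]
      congr 1; ring)
    (fun n m => by
      simp only [smul_lie, lie_smul, lie_vL_vX, smul_smul, ← zpow_mul_zpow_smul]
      congr 1; ring)
    (fun n m => by simp only [smul_lie, lie_smul, lie_vX_vX, smul_zero])
    (fun n => by
      simp only [map_smul, linMap_vL, smul_smul, ← Units.val_mul, ← mul_zpow,
        inv_mul_cancel, one_zpow, Units.val_one, one_smul])
    (fun n => by
      simp only [map_smul, linMap_vX, smul_smul, ← Units.val_mul, ← mul_zpow,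
        inv_mul_cancel, one_zpow, Units.val_one, one_smul])
    (fun n => by
      simp only [map_smul, linMap_vL, smul_smul, ← Units.val_mul, ← mul_zpow,
        mul_inv_cancel, one_zpow, Units.val_one, one_smul])
    (fun n => by
      simp only [map_smul, linMap_vX, smul_smul, ← Units.val_mul, ← mul_zpow,
        mul_inv_cancel, one_zpow, Units.val_one, one_smul])

/-- `μ_ξ : L_n ↦ L_n, X_n ↦ ξ X_n`. -/
def muAut (ξ : ℂˣ) : AutWX X lam :=
  mkAut (fun n => vL X lam n) (fun n => (ξ : ℂ) • vX X lam n)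
    (fun n => vL X lam n) (fun n => ((ξ⁻¹ : ℂˣ) : ℂ) • vX X lam n)
    (fun n m => lie_vL_vL n m)
    (fun n m => by simp only [lie_smul, lie_vL_vX, smul_smul, mul_comm])
    (fun n m => by simp only [smul_lie, lie_smul, lie_vX_vX, smul_zero])
    (fun n => linMap_vL _ _ n)
    (fun n => by simp only [map_smul, linMap_vX, smul_smul]; simp)
    (fun n => linMap_vL _ _ n)
    (fun n => by simp only [map_smul, linMap_vX, smul_smul]; simp)

/-- `L_n ↦ L_n + γ_n X_n, X_n ↦ X_n`, for a family `γ` that makes this an automorphism. -/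
def shiftAut (γ : ℤ → ℂ)
    (hγ : ∀ n m, omega X lam n m * γ m - omega X lam m n * γ n = ((m : ℂ) - n) * γ (n + m)) :
    AutWX X lam :=
  mkAut (fun n => vL X lam n + γ n • vX X lam n) (fun n => vX X lam n)
    (fun n => vL X lam n - γ n • vX X lam n) (fun n => vX X lam n)
    (fun n m => by
      simp only [lie_add, add_lie, smul_lie, lie_smul, lie_vL_vL, lie_vL_vX, lie_vX_vL, lie_vX_vX,
        smul_add, smul_smul, smul_zero, add_zero, ← hγ, sub_smul, smul_neg]
      rw [mul_comm (γ m), mul_comm (γ n)]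
      abel)
    (fun n m => by simp only [add_lie, smul_lie, lie_vL_vX, lie_vX_vX, smul_zero, add_zero])
    (fun n m => lie_vX_vX n m)
    (fun n => by simp only [map_sub, map_smul, linMap_vL, linMap_vX]; abel)
    (fun n => linMap_vX _ _ n)
    (fun n => by simp only [map_add, map_smul, linMap_vL, linMap_vX]; abel)
    (fun n => linMap_vX _ _ n)

/-- The coefficient of `X_n` in `φ_a(L_n)`. -/
def phiCoeff : Kind → OnePoint ℂ → ℂ → ℤ → ℂ
  | .A, _, a, n => a * (n : ℂ) ^ 2
  | .B, lam, a, n => if n = 0 then lam.elim a fun l => (l + 1) * a else a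

open Classical in
/-- The coefficient of `X_n` in `ψ_b(L_n)`; on `𝒲_B(λ)` with `λ ≠ 0`, `ψ_b` is the identity. -/
def psiCoeff : Kind → OnePoint ℂ → ℂ → ℤ → ℂ
  | .A, _, b, n => b * n
  | .B, lam, b, n => if lam = ((0 : ℂ) : OnePoint ℂ) then b * n else 0

theorem omega_mul_zero_coeff (γ : ℤ → ℂ) (h0 : γ 0 = 0) (n m : ℤ) :
    omega .A lam n m * γ m = ((n : ℂ) + m) * γ m := by
  rcases eq_or_ne m 0 with rfl | hm
  · simp [h0]
  · simp [omega, hm]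

theorem phiCoeff_cocycle (a : ℂ) (n m : ℤ) :
    omega X lam n m * phiCoeff X lam a m - omega X lam m n * phiCoeff X lam a n
      = ((m : ℂ) - n) * phiCoeff X lam a (n + m) := by
  cases X with
  | A =>
    have h0 : phiCoeff .A lam a 0 = 0 := by simp [phiCoeff]
    rw [omega_mul_zero_coeff lam _ h0, omega_mul_zero_coeff lam _ h0]
    simp only [phiCoeff]
    push_cast
    ring
  | B =>
    by_cases hs : n + m = 0
    · obtain rfl : m = -n := by omega
      rcases eq_or_ne n 0 with rfl | hn
      · simp
      · induction lam using OnePoint.rec <;> simp [omega, phiCoeff, defect, hn] <;> ring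
    · have hs' : m + n ≠ 0 := by omega
      rcases eq_or_ne n 0 with rfl | hn
      · rcases eq_or_ne m 0 with rfl | hm
        · simp
        · simp [omega, phiCoeff, hm]
      · rcases eq_or_ne m 0 with rfl | hm
        · simp [omega, phiCoeff, hn]
        · simp [omega, phiCoeff, hn, hm, hs, hs']; ring

theorem psiCoeff_cocycle (b : ℂ) (n m : ℤ) :
    omega X lam n m * psiCoeff X lam b m - omega X lam m n * psiCoeff X lam b n
      = ((m : ℂ) - n) * psiCoeff X lam b (n + m) := by
  cases X with
  | A =>
    have h0 : psiCoeff .A lam b 0 = 0 := by simp [psiCoeff]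
    rw [omega_mul_zero_coeff lam _ h0, omega_mul_zero_coeff lam _ h0]
    simp only [psiCoeff]
    push_cast
    ring
  | B =>
    by_cases h : lam = ((0 : ℂ) : OnePoint ℂ)
    · subst h
      simp [omega, psiCoeff, defect]
      ring
    · simp [psiCoeff, h]

/-- `φ_a`. -/
def phiAut (a : ℂ) : AutWX X lam :=
  shiftAut X lam (phiCoeff X lam a) (phiCoeff_cocycle X lam a)

/-- `ψ_b`. -/
def psiAut (b : ℂ) : AutWX X lam :=
  shiftAut X lam (psiCoeff X lam b) (psiCoeff_cocycle X lam b)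

open Classical in
/-- The coefficient of `X_{-n}` in `τ_λ(X_n)`. -/
def tauCoeff (n : ℤ) : ℂ := if lam = ((-1 : ℂ) : OnePoint ℂ) ∧ n = 0 then -1 else 1

theorem tauCoeff_mul_self (n : ℤ) : tauCoeff lam n * tauCoeff lam n = 1 := by
  unfold tauCoeff
  split_ifs <;> simp

theorem tauCoeff_neg (n : ℤ) : tauCoeff lam (-n) = tauCoeff lam n := by
  rcases eq_or_ne n 0 with rfl | hn
  · rw [neg_zero]
  · simp [tauCoeff, hn]

theorem omega_tau (h : lam = ((0 : ℂ) : OnePoint ℂ) ∨ lam = ((-1 : ℂ) : OnePoint ℂ)) (n m : ℤ) :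
    -(tauCoeff lam m * omega X lam (-n) (-m)) = omega X lam n m * tauCoeff lam (n + m) := by
  rcases h with rfl | rfl
  · have h1 : ((0 : ℂ) : OnePoint ℂ) ≠ ((-1 : ℂ) : OnePoint ℂ) := by
      rw [Ne, OnePoint.coe_eq_coe]; norm_num
    cases X
    · simp [omega, tauCoeff, h1, defect]; ring
    · simp [omega, tauCoeff, h1, defect]
  · cases X with
    | A =>
      rcases eq_or_ne m 0 with rfl | hm
      · rcases eq_or_ne n 0 with rfl | hn
        · simp [omega, tauCoeff, defect]
        · simp [omega, tauCoeff, defect, hn]; ring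
      · by_cases hs : n + m = 0
        · obtain rfl : m = -n := by omega
          have hn : n ≠ 0 := by omega
          simp [omega, tauCoeff, hn]
        · simp [omega, tauCoeff, hm, hs]; ring
    | B =>
      by_cases hs : n + m = 0
      · obtain rfl : m = -n := by omega
        rcases eq_or_ne n 0 with rfl | hn
        · simp [omega, tauCoeff, defect]
        · simp [omega, tauCoeff, defect, hn]; ring
      · have hs' : ¬ (-n + -m = 0) := by omega
        rcases eq_or_ne m 0 with rfl | hm
        · simp [omega, tauCoeff] at hs ⊢
          simp [hs]
        · simp [omega, tauCoeff, hm, hs, hs']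

open Classical in
/-- `τ_λ : L_n ↦ -L_{-n}, X_n ↦ X_{-n}` for `λ ∈ {0, -1}`, except that `X_0 ↦ -X_0` if `λ = -1`;
and `τ_λ = id` for all other `λ`. -/
def tauAut : AutWX X lam :=
  if h : lam = ((0 : ℂ) : OnePoint ℂ) ∨ lam = ((-1 : ℂ) : OnePoint ℂ) then
    mkAut (fun n => -vL X lam (-n)) (fun n => tauCoeff lam n • vX X lam (-n))
      (fun n => -vL X lam (-n)) (fun n => tauCoeff lam n • vX X lam (-n))
      (fun n m => by
        simp only [neg_lie, lie_neg, neg_neg, lie_vL_vL, smul_neg, ← neg_smul]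
        rw [neg_add]
        congr 1
        push_cast
        ring)
      (fun n m => by
        simp only [neg_lie, lie_smul, lie_vL_vX, smul_smul]
        rw [neg_add, ← omega_tau X lam h, neg_smul, smul_neg, smul_smul])
      (fun n m => by simp only [smul_lie, lie_smul, lie_vX_vX, smul_zero])
      (fun n => by simp only [map_neg, linMap_vL, neg_neg])
      (fun n => by
        simp only [map_smul, linMap_vX, smul_smul, neg_neg, tauCoeff_neg, tauCoeff_mul_self,
          one_smul])
      (fun n => by simp only [map_neg, linMap_vL, neg_neg])
      (fun n => by
        simp only [map_smul, linMap_vX, smul_smul, neg_neg, tauCoeff_neg, tauCoeff_mul_self,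
          one_smul])
  else 1

/-- `Φ_{k;a,b;α,ξ} = τ_λ^k ∘ φ_a ∘ ψ_b ∘ σ_α ∘ μ_ξ`. -/
def PhiAut (k : ZMod 2) (a b : ℂ) (α ξ : ℂˣ) : AutWX X lam :=
  tauAut X lam ^ k.val * phiAut X lam a * psiAut X lam b * sigmaAut X lam α * muAut X lam ξ

open Classical in
/-- `ϖ_a` on `𝒲_A(λ)`: it is `φ_a` if `λ = 0`, and `ψ_a` otherwise. -/
def varpiAut (a : ℂ) : AutWX .A lam :=
  if lam = ((0 : ℂ) : OnePoint ℂ) then phiAut .A lam a else psiAut .A lam a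

/-- `Ψ_{k;a;α,ξ} = τ_λ^k ∘ ϖ_a ∘ σ_α ∘ μ_ξ` on `𝒲_A(λ)`. -/
def PsiAut (k : ZMod 2) (a : ℂ) (α ξ : ℂˣ) : AutWX .A lam :=
  tauAut .A lam ^ k.val * varpiAut lam a * sigmaAut .A lam α * muAut .A lam ξ

/-- The set `G_X(λ)`. -/
def outerSet : (X : Kind) → (lam : OnePoint ℂ) → Set (AutWX X lam)
  | .A, lam => {σ | ∃ (k : ZMod 2) (a : ℂ) (α ξ : ℂˣ), σ = PsiAut lam k a α ξ}
  | .B, lam => {σ | ∃ (k : ZMod 2) (a b : ℂ) (α ξ : ℂˣ), σ = PhiAut .B lam k a b α ξ}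

/-- The element `∑ y_i X_i` of the abelian ideal `X(λ)`. -/
def vSum (y : ℤ →₀ ℂ) : WX X lam := y.sum fun i c => c • vX X lam i

end

/-- `ℂ^∞`, the additive group of finitely supported sequences `(z_i)_{i ∈ ℤ}`. -/
abbrev CInf : Type := ℤ →₀ ℂ

/-- `ℂ_0^∞`, the subgroup of `ℂ^∞` of all sequences with `z_0 = 0`. -/
def CInfZero : AddSubgroup CInf where
  carrier := {z | z 0 = 0}
  add_mem' {x y} hx hy := by
    change (x + y) 0 = 0
    rw [Finsupp.add_apply, show x 0 = 0 from hx, show y 0 = 0 from hy, add_zero]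
  zero_mem' := rfl
  neg_mem' {x} hx := by
    change (-x) 0 = 0
    rw [Finsupp.neg_apply, show x 0 = 0 from hx, neg_zero]

/-- The sign `(-1)^k`. -/
def sgn (k : ZMod 2) : ℤ := if k = 0 then 1 else -1

section coordinates
variable {N V : Type} [AddCommGroup N] [AddCommGroup V]

/-- The element `(y, v, α, ξ)` of `N ⋊ (V ⋊ (ℂˣ × ℂˣ))`. -/
def tuple {θ₁ : ℂˣ × ℂˣ →* MulAut (Multiplicative V)}
    {θ₂ : (Multiplicative V ⋊[θ₁] (ℂˣ × ℂˣ)) →* MulAut (Multiplicative N)}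
    (y : N) (v : V) (α ξ : ℂˣ) :
    Multiplicative N ⋊[θ₂] (Multiplicative V ⋊[θ₁] (ℂˣ × ℂˣ)) :=
  ⟨Multiplicative.ofAdd y, ⟨Multiplicative.ofAdd v, (α, ξ)⟩⟩

/-- The element `(y, k, v, α, ξ)` of `N ⋊ (ℤ/2 ⋉ (V ⋊ (ℂˣ × ℂˣ)))`. The group `K ⋉ H` is the
semidirect product `H ⋊ K`, and its element `(k, h)` is the product `k · h`. -/
def tuple₂ {θ₁ : ℂˣ × ℂˣ →* MulAut (Multiplicative V)}
    {θ₂ : Multiplicative (ZMod 2) →* MulAut (Multiplicative V ⋊[θ₁] (ℂˣ × ℂˣ))}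
    {θ₃ : ((Multiplicative V ⋊[θ₁] (ℂˣ × ℂˣ)) ⋊[θ₂] Multiplicative (ZMod 2)) →*
      MulAut (Multiplicative N)}
    (y : N) (k : ZMod 2) (v : V) (α ξ : ℂˣ) :
    Multiplicative N ⋊[θ₃]
      ((Multiplicative V ⋊[θ₁] (ℂˣ × ℂˣ)) ⋊[θ₂] Multiplicative (ZMod 2)) :=
  ⟨Multiplicative.ofAdd y,
    SemidirectProduct.inr (Multiplicative.ofAdd k) *
      SemidirectProduct.inl ⟨Multiplicative.ofAdd v, (α, ξ)⟩⟩

end coordinates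

end WittSum

end

open WittSum LieAut

namespace WittSum

noncomputable section

/-! The ideal `X(λ)` is intrinsic: its elements are those `x` with `[x,[y,x]] = 0` for all `y`,
because outside the ideal a suitable choice of `y` leaves a nonzero leading term. Hence every
automorphism `σ` acts on the quotient `𝒲`. Leading terms also force `σ(L_0) ≡ c L_0` modulo the
ideal: if the extreme degree `N` of `σ(L_0)` lay strictly beyond `0`, bracketing with `σ(L_0)` would
pin every `σ(L_n)` to the same extreme degree `N`, against surjectivity. Comparing eigenvalues of
`L_0` then gives `σ(L_n) ≡ ε α^n L_{εn}` with `ε = ±1` (`exists_rightC_aut`).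

The same eigenvalues send `X_n` to a multiple of `X_{εn}`. Compatibility with `ω` leaves one free
scalar `ξ`. If `ε = -1`, it also forces `(1+2λ)² = 1`, that is `λ ∈ {0,-1}`, and the sign at `X_0`
is `1+2λ` (`eq_const_of_omega`, `eq_tauCoeff_of_omega`). Dividing by `τ_λ`, `σ_α`, `μ_ξ` leaves an
automorphism trivial on `X(λ)` and on `𝒲`, which is a 1-cocycle `𝒲 → X(λ)`. Since `L_0` acts on
`X_k` by `k`, an inner automorphism removes all nonzero weights (`exists_unipotent`). The
weight-zero cocycles solve a functional equation whose solutions are quadratic polynomials, and they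
are combinations of those of `φ_a` and `ψ_b` (`IsCocycle.exists_coeff`).

On the inner side, a locally nilpotent `ad_x` forces `x ∈ X(λ)`, so `ad_x² = 0` and `exp(ad_x) = 1 +
ad_x` is additive in `x`. Only `X_0` can overlap with the outer part: it gives the coboundary `n ↦
ω(n,0)`. On `A(λ)` this cuts the two-parameter cocycle space down to one parameter; on `B(λ)` it
vanishes, so `B_0` is central and the coordinate `y_0` is dropped. `OuterData` records a complement
to this coboundary, and a single argument then yields the semidirect product in all cases. The group
law comes from `σ exp(ad_x) σ⁻¹ = exp(ad_{σx})`. -/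

/-! ### Graded products and their leading terms -/

theorem gradedMul_apply (c : ℤ → ℤ → ℂ) (x y : ℤ →₀ ℂ) (k : ℤ) :
    gradedMul c x y k = ∑ n ∈ x.support, x n * (y (k - n) * c n (k - n)) := by
  change _ = x.sum fun n a => a * (y (k - n) * c n (k - n))
  induction x using Finsupp.induction_linear with
  | zero => simp
  | add x x' hx hx' =>
    rw [Finsupp.sum_add_index' (by simp) (by intros; ring), ← hx, ← hx']
    simp
  | single n a =>
    rw [Finsupp.sum_single_index (by simp)]
    induction y using Finsupp.induction_linear with
    | zero => simp
    | add y y' hy hy' => rw [map_add, Finsupp.add_apply, hy, hy', Finsupp.add_apply]; ring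
    | single m b =>
      rw [gradedMul_single]
      by_cases h : n + m = k
      · obtain rfl : m = k - n := by omega
        simp
      · rw [Finsupp.single_eq_of_ne (by omega), Finsupp.single_eq_of_ne (by omega)]
        ring

theorem gradedMul_single_apply (c : ℤ → ℤ → ℂ) (n : ℤ) (a : ℂ) (y : ℤ →₀ ℂ) (k : ℤ) :
    gradedMul c (Finsupp.single n a) y k = a * (y (k - n) * c n (k - n)) := by
  rcases eq_or_ne a 0 with rfl | ha
  · simp
  · rw [gradedMul_apply, Finsupp.support_single _ ha, Finset.sum_singleton, Finsupp.single_eq_same]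

/-- The coefficient of `x` at `N` is nonzero, and `δ n ≤ δ N` for all `n` in the support. -/
def IsTop (δ : ℤ) (x : ℤ →₀ ℂ) (N : ℤ) : Prop :=
  x N ≠ 0 ∧ ∀ n, x n ≠ 0 → δ * n ≤ δ * N

theorem exists_isTop (δ : ℤ) {x : ℤ →₀ ℂ} (hx : x ≠ 0) : ∃ N, IsTop δ x N := by
  obtain ⟨N, hN, h⟩ := Finset.exists_max_image x.support (fun n => δ * n)
    (Finsupp.support_nonempty_iff.2 hx)
  exact ⟨N, Finsupp.mem_support_iff.1 hN, fun n hn => h n (Finsupp.mem_support_iff.2 hn)⟩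

theorem isTop_single (δ n : ℤ) : IsTop δ (Finsupp.single n 1) n :=
  ⟨by simp, fun m hm => by
    by_contra h
    exact hm (Finsupp.single_eq_of_ne (by rintro rfl; exact h le_rfl))⟩

theorem IsTop.ne_zero {δ : ℤ} {x : ℤ →₀ ℂ} {N : ℤ} (h : IsTop δ x N) : x ≠ 0 := by
  rintro rfl
  exact h.1 rfl

/-- The leading coefficient of a product. -/
theorem IsTop.gradedMul {δ : ℤ} (hδ : δ ≠ 0) {c : ℤ → ℤ → ℂ} {x y : ℤ →₀ ℂ} {N M : ℤ}
    (hx : IsTop δ x N) (hy : IsTop δ y M) (hc : c N M ≠ 0) :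
    IsTop δ (gradedMul c x y) (N + M) := by
  constructor
  · rw [gradedMul_apply, Finset.sum_eq_single N]
    · rw [add_sub_cancel_left]
      exact mul_ne_zero hx.1 (mul_ne_zero hy.1 hc)
    · intro n hn hnN
      have h1 := hx.2 n (Finsupp.mem_support_iff.1 hn)
      by_cases h : y (N + M - n) = 0
      · rw [h]; ring
      · have h2 := hy.2 _ h
        -- Another pair of degrees with sum `N + M` would need both `δ n ≤ δ N` and `δ (N + M - n) ≤
        -- δ M`; these force `δ n = δ N`.
        refine absurd (mul_left_cancel₀ hδ (le_antisymm h1 ?_)) hnN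
        linarith [mul_sub δ (N + M) n, mul_add δ N M]
    · intro h
      exact absurd (Finsupp.notMem_support_iff.1 h) hx.1
  · intro k hk
    rw [gradedMul_apply] at hk
    obtain ⟨n, hn, h⟩ := Finset.exists_ne_zero_of_sum_ne_zero hk
    have h1 := hx.2 n (Finsupp.mem_support_iff.1 hn)
    have h2 := hy.2 (k - n) (fun h0 => h (by rw [h0]; ring))
    linarith [mul_sub δ k n, mul_add δ N M]

/-! ### Coordinates on the semidirect sum -/

section coordinates

variable {X : Kind} {lam : OnePoint ℂ}

/-- The coordinates with respect to the `L_n`. -/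
def rightC : WX X lam →ₗ[ℂ] (ℤ →₀ ℂ) where
  toFun x := x.right
  map_add' _ _ := rfl
  map_smul' _ _ := rfl

/-- The coordinates with respect to the `X_n`. -/
def leftC : WX X lam →ₗ[ℂ] (ℤ →₀ ℂ) where
  toFun x := x.left
  map_add' _ _ := rfl
  map_smul' _ _ := rfl

theorem wx_ext {x y : WX X lam} (h1 : rightC x = rightC y) (h2 : leftC x = leftC y) : x = y :=
  LieAlgebra.SemiDirectSum.ext h2 h1

theorem rightC_lie (x y : WX X lam) :
    rightC ⁅x, y⁆ = gradedMul wittCoeff (rightC x) (rightC y) := rfl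

theorem leftC_lie (x y : WX X lam) :
    leftC ⁅x, y⁆ = gradedMul (omega X lam) (rightC x) (leftC y) -
      gradedMul (omega X lam) (rightC y) (leftC x) := by
  have : leftC ⁅x, y⁆ = 0 + gradedMul (omega X lam) (rightC x) (leftC y) -
      gradedMul (omega X lam) (rightC y) (leftC x) := rfl
  rw [this, zero_add]

@[simp] theorem rightC_vL (n : ℤ) : rightC (vL X lam n) = Finsupp.single n 1 := rfl
@[simp] theorem leftC_vL (n : ℤ) : leftC (vL X lam n) = 0 := rfl
@[simp] theorem rightC_vX (n : ℤ) : rightC (vX X lam n) = 0 := rfl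
@[simp] theorem leftC_vX (n : ℤ) : leftC (vX X lam n) = Finsupp.single n 1 := rfl

theorem vSum_add (y z : ℤ →₀ ℂ) : vSum X lam (y + z) = vSum X lam y + vSum X lam z :=
  Finsupp.sum_add_index' (by simp) (by intros; rw [add_smul])

theorem vSum_single (n : ℤ) (a : ℂ) : vSum X lam (Finsupp.single n a) = a • vX X lam n :=
  Finsupp.sum_single_index (by simp)

@[simp] theorem rightC_vSum (y : ℤ →₀ ℂ) : rightC (vSum X lam y) = 0 := by
  induction y using Finsupp.induction_linear with
  | zero => rw [vSum, Finsupp.sum_zero_index, map_zero]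
  | add y z hy hz => rw [vSum_add, map_add, hy, hz, add_zero]
  | single n a => rw [vSum_single, map_smul, rightC_vX, smul_zero]

@[simp] theorem leftC_vSum (y : ℤ →₀ ℂ) : leftC (vSum X lam y) = y := by
  induction y using Finsupp.induction_linear with
  | zero => rw [vSum, Finsupp.sum_zero_index, map_zero]
  | add y z hy hz => rw [vSum_add, map_add, hy, hz]
  | single n a => rw [vSum_single, map_smul, leftC_vX]; simp

theorem vSum_leftC {x : WX X lam} (hx : rightC x = 0) : vSum X lam (leftC x) = x :=
  wx_ext (by rw [rightC_vSum, hx]) (leftC_vSum _)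

theorem lie_eq_zero {x y : WX X lam} (hx : rightC x = 0) (hy : rightC y = 0) : ⁅x, y⁆ = 0 :=
  wx_ext (by rw [rightC_lie, hx, map_zero, map_zero, LinearMap.zero_apply])
    (by rw [leftC_lie, hx, hy, map_zero, map_zero, LinearMap.zero_apply, LinearMap.zero_apply,
      sub_zero])

theorem aut_ext {σ σ' : AutWX X lam} (hL : ∀ n, σ (vL X lam n) = σ' (vL X lam n))
    (hX : ∀ n, σ (vX X lam n) = σ' (vX X lam n)) : σ = σ' := by
  refine LieEquiv.ext fun x => ?_
  induction x using wx_induction with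
  | zero => rw [map_zero, map_zero]
  | add x y hx hy => rw [map_add, map_add, hx, hy]
  | smul c x hx => rw [map_smul, map_smul, hx]
  | hL n => exact hL n
  | hX n => exact hX n

theorem one_apply (x : WX X lam) : (1 : AutWX X lam) x = x := rfl

theorem aut_inv_apply_self (σ : AutWX X lam) (x : WX X lam) : σ⁻¹ (σ x) = x := by
  rw [← mul_apply, inv_mul_cancel, one_apply]

theorem aut_apply_inv_self (σ : AutWX X lam) (x : WX X lam) : σ (σ⁻¹ x) = x := by
  rw [← mul_apply, mul_inv_cancel, one_apply]

theorem omega_zero_left (k : ℤ) : omega X lam 0 k = k := by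
  cases X <;> simp [omega, defect_zero]

end coordinates

theorem wittCoeff_ne_zero {n m : ℤ} (h : m ≠ n) : wittCoeff n m ≠ 0 := by
  rw [wittCoeff, sub_ne_zero]
  exact_mod_cast h

theorem gradedMul_zero_left (c : ℤ → ℤ → ℂ) (y : ℤ →₀ ℂ) : gradedMul c 0 y = 0 := by
  rw [map_zero, LinearMap.zero_apply]

/-! ### The action of an automorphism on the quotient and on the ideal -/

section classification

variable {X : Kind} {lam : OnePoint ℂ}

/-- If the Witt part of `x` has top degree `N`, then `[x,[L_m,x]]` has a nonzero term in degree `2N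
+ m` as soon as `m` differs from `0` and `N`. This characterises the ideal by brackets alone, so
automorphisms must respect it. -/
theorem rightC_eq_zero_of_lie {x : WX X lam} (h : ∀ y : WX X lam, ⁅x, ⁅y, x⁆⁆ = 0) :
    rightC x = 0 := by
  by_contra hx
  obtain ⟨N, hN⟩ := exists_isTop 1 hx
  obtain ⟨m, hm0, hmN⟩ : ∃ m : ℤ, m ≠ 0 ∧ m ≠ N := by
    rcases eq_or_ne N 1 with rfl | h1
    · exact ⟨2, by norm_num, by norm_num⟩
    · exact ⟨1, by norm_num, h1.symm⟩
  have h1 := IsTop.gradedMul one_ne_zero (isTop_single 1 m) hN (wittCoeff_ne_zero hmN.symm)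
  have h2 := IsTop.gradedMul one_ne_zero hN h1 (wittCoeff_ne_zero (by omega))
  apply h2.ne_zero
  rw [← rightC_vL (X := X) (lam := lam), ← rightC_lie, ← rightC_lie, h, map_zero]

variable (σ : AutWX X lam)

/-- The bracket condition above holds on the ideal because it is abelian, and it is transported by
`σ`. -/
theorem rightC_aut_eq_zero {x : WX X lam} (hx : rightC x = 0) : rightC (σ x) = 0 := by
  refine rightC_eq_zero_of_lie fun y => ?_
  rw [← aut_apply_inv_self σ y, ← LieEquiv.map_lie, ← LieEquiv.map_lie, lie_eq_zero hx, map_zero]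
  rw [rightC_lie, hx, map_zero]

theorem rightC_aut_eq_zero_iff {x : WX X lam} : rightC (σ x) = 0 ↔ rightC x = 0 :=
  ⟨fun h => by simpa only [aut_inv_apply_self] using rightC_aut_eq_zero σ⁻¹ h,
    rightC_aut_eq_zero σ⟩

theorem vL_right_ne_zero (n : ℤ) : rightC (vL X lam n) ≠ 0 := by
  rw [rightC_vL]
  exact (isTop_single 1 n).ne_zero

/-- Surjectivity modulo the ideal: if degree `k` were missed by all `σ(L_n)`, then `L_k` would not
be in the image. -/
theorem exists_rightC_aut_apply_ne_zero (k : ℤ) : ∃ n, rightC (σ (vL X lam n)) k ≠ 0 := by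
  by_contra! h
  have key : ∀ x, rightC (σ x) k = 0 := by
    intro x
    induction x using wx_induction with
    | zero => rw [map_zero, map_zero, Finsupp.zero_apply]
    | add x y hx hy => rw [map_add, map_add, Finsupp.add_apply, hx, hy, add_zero]
    | smul c x hx => rw [map_smul, map_smul, Finsupp.smul_apply, hx, smul_zero]
    | hL n => exact h n
    | hX n => rw [rightC_aut_eq_zero σ (rightC_vX n), Finsupp.zero_apply]
  have := key (σ⁻¹ (vL X lam k))
  rw [aut_apply_inv_self, rightC_vL, Finsupp.single_eq_same] at this
  exact one_ne_zero this

theorem rightC_aut_lie_vL (n m : ℤ) :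
    gradedMul wittCoeff (rightC (σ (vL X lam n))) (rightC (σ (vL X lam m))) =
      ((m : ℂ) - n) • rightC (σ (vL X lam (n + m))) := by
  rw [← rightC_lie, ← LieEquiv.map_lie, lie_vL_vL, map_smul, map_smul]

/-- The sign `δ = ±1` treats highest and lowest degrees at once. If `σ(L_n)` had extreme degree `d ≠
N`, then `[σ(L_0), σ(L_n)] = n σ(L_n)` would reach degree `N + d`, strictly beyond `d`. So all
`σ(L_n)` share the extreme degree `N`, and degree `N + δ` is never attained. -/
theorem isTop_rightC_aut_nonpos {δ : ℤ} (hδ : δ * δ = 1) {N : ℤ}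
    (hN : IsTop δ (rightC (σ (vL X lam 0))) N) : δ * N ≤ 0 := by
  by_contra! hpos
  have hδ0 : δ ≠ 0 := by rintro rfl; simp at hδ
  have key : ∀ n, IsTop δ (rightC (σ (vL X lam n))) N := by
    intro n
    obtain ⟨d, hd⟩ := exists_isTop δ
      ((rightC_aut_eq_zero_iff σ).not.2 (vL_right_ne_zero (X := X) (lam := lam) n))
    by_cases hdN : d = N
    · exact hdN ▸ hd
    · exfalso
      have h := (IsTop.gradedMul hδ0 hN hd (wittCoeff_ne_zero hdN)).1
      rw [rightC_aut_lie_vL, zero_add] at h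
      have := hd.2 _ (right_ne_zero_of_mul h)
      linarith [mul_add δ N d]
  obtain ⟨n, hn⟩ := exists_rightC_aut_apply_ne_zero σ (N + δ)
  have := (key n).2 _ hn
  linarith [mul_add δ N δ]

/-- An automorphism acts on the quotient by `X(λ)` as `L_n ↦ ε α^n L_{ε n}`. -/
theorem exists_rightC_aut : ∃ (ε : ℤ) (α : ℂˣ), (ε = 1 ∨ ε = -1) ∧ ∀ n,
    rightC (σ (vL X lam n)) = Finsupp.single (ε * n) ((ε : ℂ) * ((α ^ n : ℂˣ) : ℂ)) := by
  have hne : ∀ n, rightC (σ (vL X lam n)) ≠ 0 := fun n =>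
    (rightC_aut_eq_zero_iff σ).not.2 (vL_right_ne_zero (X := X) (lam := lam) n)
  obtain ⟨c, hc⟩ : ∃ c, rightC (σ (vL X lam 0)) = Finsupp.single 0 c := by
    refine ⟨rightC (σ (vL X lam 0)) 0, ?_⟩
    ext k
    by_cases hk : rightC (σ (vL X lam 0)) k = 0
    · rcases eq_or_ne k 0 with rfl | hk0
      · simp
      · rw [hk, Finsupp.single_eq_of_ne hk0]
    · obtain ⟨N, hN⟩ := exists_isTop 1 (hne 0)
      obtain ⟨M, hM⟩ := exists_isTop (-1) (hne 0)
      have h1 := isTop_rightC_aut_nonpos σ (by norm_num) hN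
      have h2 := isTop_rightC_aut_nonpos σ (by norm_num) hM
      have h3 := hN.2 _ hk
      have h4 := hM.2 _ hk
      obtain rfl : k = 0 := by linarith
      simp
  -- Eigenvalue comparison: `σ(L_n)` has `ad σ(L_0)`-eigenvalue `n`, while modulo the ideal `c L_0`
  -- acts on `L_k` by `c k`.
  have hwt : ∀ n k, rightC (σ (vL X lam n)) k ≠ 0 → c * k = n := by
    intro n k hk
    have h := DFunLike.congr_fun (rightC_aut_lie_vL σ 0 n) k
    rw [hc, gradedMul_single_apply, Finsupp.smul_apply, sub_zero, zero_add, wittCoeff,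
      smul_eq_mul] at h
    apply mul_left_cancel₀ hk
    push_cast at h
    linear_combination h
  -- Some `σ(L_n)` involves `L_1`, so `c` is an integer; a degree occurring in `σ(L_1)` shows that
  -- it divides `1`.
  obtain ⟨ε, hε⟩ := exists_rightC_aut_apply_ne_zero σ 1
  have hcε : c = ε := by simpa using hwt _ _ hε
  have hεε : ε = 1 ∨ ε = -1 := by
    obtain ⟨k, hk⟩ := DFunLike.ne_iff.1 (hne 1)
    have := hwt _ _ hk
    rw [hcε] at this
    exact Int.isUnit_iff.1 (IsUnit.of_mul_eq_one k (by exact_mod_cast this))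
  have hεsq : ε * ε = 1 := by rcases hεε with rfl | rfl <;> norm_num
  have hεsq' : (ε : ℂ) * ε = 1 := by exact_mod_cast hεsq
  have hsupp : ∀ n k, rightC (σ (vL X lam n)) k ≠ 0 → k = ε * n := by
    intro n k hk
    have := hwt n k hk
    rw [hcε] at this
    have h' : ε * k = n := by exact_mod_cast this
    rw [← h', ← mul_assoc, hεsq, one_mul]
  obtain ⟨b, hb⟩ : ∃ b : ℤ → ℂ, ∀ n,
      rightC (σ (vL X lam n)) = Finsupp.single (ε * n) ((ε : ℂ) * b n) := by
    refine ⟨fun n => ε * rightC (σ (vL X lam n)) (ε * n), fun n => ?_⟩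
    rw [← mul_assoc, hεsq', one_mul]
    ext k
    by_cases hk : k = ε * n
    · rw [hk, Finsupp.single_eq_same]
    · rw [Finsupp.single_eq_of_ne hk]
      exact not_not.1 fun h => hk (hsupp n k h)
  have hb0 : ∀ n, b n ≠ 0 := by
    intro n h
    apply hne n
    rw [hb, h, mul_zero, Finsupp.single_zero]
  have hrel : ∀ n m, n ≠ m → b (n + m) = b n * b m := by
    intro n m hnm
    have h := DFunLike.congr_fun (rightC_aut_lie_vL σ n m) (ε * (n + m))
    rw [hb, hb, hb, gradedMul_single, Finsupp.smul_apply, ← mul_add, Finsupp.single_eq_same,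
      Finsupp.single_eq_same, wittCoeff, smul_eq_mul] at h
    have h2 : ((m : ℂ) - n) ≠ 0 := by
      rw [sub_ne_zero]; exact_mod_cast hnm.symm
    have hε0 : (ε : ℂ) ≠ 0 := left_ne_zero_of_mul (hεsq'.symm ▸ one_ne_zero)
    apply mul_left_cancel₀ (mul_ne_zero h2 hε0)
    push_cast at h
    linear_combination -h + (b n * b m * ε * (m - n)) * hεsq'
  -- The relation for `L_n` and `L_m` is empty when `n = m`, so `1 + 1` is reached indirectly, by
  -- computing `b 5` through `4 + 1` and through `3 + 2`.
  have hb2 : b 2 = b 1 * b 1 := by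
    have h3 : b 3 = b 2 * b 1 := hrel 2 1 (by norm_num)
    have h4 : b 4 = b 3 * b 1 := hrel 3 1 (by norm_num)
    have h5 : b 5 = b 4 * b 1 := hrel 4 1 (by norm_num)
    have h5' : b 5 = b 3 * b 2 := hrel 3 2 (by norm_num)
    apply mul_left_cancel₀ (hb0 3)
    rw [← h5', h5, h4, mul_assoc]
  have hsucc : ∀ n, b (n + 1) = b n * b 1 := by
    intro n
    rcases eq_or_ne n 1 with rfl | h
    · exact hb2
    · exact hrel n 1 h
  have hbz : b 0 = 1 := by
    have := hsucc 0
    rw [zero_add] at this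
    exact mul_right_cancel₀ (hb0 1) (by rw [← this, one_mul])
  refine ⟨ε, Units.mk0 (b 1) (hb0 1), hεε, fun n => ?_⟩
  rw [hb]
  congr 2
  induction n using Int.induction_on with
  | zero => simp [hbz]
  | succ n ih => rw [hsucc, ih, zpow_add_one, Units.val_mul, Units.val_mk0]
  | pred n ih =>
    apply mul_right_cancel₀ (hb0 1)
    rw [← hsucc, sub_add_cancel, ih]
    nth_rewrite 3 [← Units.val_mk0 (hb0 1)]
    rw [← Units.val_mul, ← zpow_add_one, sub_add_cancel]

/-- The `L_0`-weight forces `σ(X_n)` to be a multiple of `X_{εn}`. Splitting off `α^n` makes `α`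
cancel from the compatibility with `L_n · X_m`, so the remaining relation involves only `c`, `ε` and
`ω`. -/
theorem exists_leftC_aut_vX {ε : ℤ} {α : ℂˣ} (hε : ε = 1 ∨ ε = -1)
    (h : ∀ n, rightC (σ (vL X lam n)) = Finsupp.single (ε * n) ((ε : ℂ) * ((α ^ n : ℂˣ) : ℂ))) :
    ∃ c : ℤ → ℂ, (∀ n, c n ≠ 0) ∧
      (∀ n, σ (vX X lam n) = (c n * ((α ^ n : ℂˣ) : ℂ)) • vX X lam (ε * n)) ∧
      ∀ n m, (ε : ℂ) * c m * omega X lam (ε * n) (ε * m) = omega X lam n m * c (n + m) := by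
  have hεsq : ε * ε = 1 := by rcases hε with rfl | rfl <;> norm_num
  have hεsq' : (ε : ℂ) * ε = 1 := by exact_mod_cast hεsq
  have hlie : ∀ n m, gradedMul (omega X lam) (rightC (σ (vL X lam n))) (leftC (σ (vX X lam m))) =
      omega X lam n m • leftC (σ (vX X lam (n + m))) := by
    intro n m
    have := congrArg leftC (congrArg σ (lie_vL_vX (X := X) (lam := lam) n m))
    rw [LieEquiv.map_lie, leftC_lie, rightC_aut_eq_zero σ (rightC_vX m), gradedMul_zero_left,
      sub_zero, map_smul, map_smul] at this
    exact this
  have hsupp : ∀ n k, k ≠ ε * n → leftC (σ (vX X lam n)) k = 0 := by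
    intro n k hk
    have h1 := DFunLike.congr_fun (hlie 0 n) k
    rw [h, mul_zero, gradedMul_single_apply, omega_zero_left, omega_zero_left, zpow_zero,
      Units.val_one, mul_one, sub_zero, zero_add, Finsupp.smul_apply, smul_eq_mul] at h1
    have h2 : (ε : ℂ) * k - n ≠ 0 := by
      rw [sub_ne_zero]
      intro h3
      have h4 : ε * k = n := by exact_mod_cast h3
      exact hk (by rw [← h4, ← mul_assoc, hεsq, one_mul])
    apply mul_left_cancel₀ h2
    linear_combination h1
  have hα : ∀ n : ℤ, ((α ^ n : ℂˣ) : ℂ) ≠ 0 := fun n => Units.ne_zero _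
  have hform : ∀ n, leftC (σ (vX X lam n)) =
      Finsupp.single (ε * n) (leftC (σ (vX X lam n)) (ε * n)) := by
    intro n
    ext k
    by_cases hk : k = ε * n
    · rw [hk, Finsupp.single_eq_same]
    · rw [Finsupp.single_eq_of_ne hk, hsupp n k hk]
  have hg : ∀ n, leftC (σ (vX X lam n)) = Finsupp.single (ε * n)
      (leftC (σ (vX X lam n)) (ε * n) / ((α ^ n : ℂˣ) : ℂ) * ((α ^ n : ℂˣ) : ℂ)) := by
    intro n
    rw [div_mul_cancel₀ _ (hα n)]
    exact hform n
  have hval : ∀ n, σ (vX X lam n) = (leftC (σ (vX X lam n)) (ε * n) / ((α ^ n : ℂˣ) : ℂ) *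
      ((α ^ n : ℂˣ) : ℂ)) • vX X lam (ε * n) := by
    intro n
    apply wx_ext
    · rw [rightC_aut_eq_zero σ (rightC_vX n), map_smul, rightC_vX, smul_zero]
    · rw [map_smul, leftC_vX, Finsupp.smul_single_one]
      exact hg n
  generalize hc : (fun n => leftC (σ (vX X lam n)) (ε * n) / ((α ^ n : ℂˣ) : ℂ)) = c at *
  have hc' : ∀ n, leftC (σ (vX X lam n)) (ε * n) / ((α ^ n : ℂˣ) : ℂ) = c n := fun n =>
    congrFun hc n
  simp only [hc'] at hg hval
  refine ⟨c, fun n h0 => ?_, hval, fun n m => ?_⟩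
  · have h1 := hval n
    rw [h0, zero_mul, zero_smul, ← map_zero σ] at h1
    have h2 := congrArg leftC (σ.injective h1)
    rw [leftC_vX, map_zero] at h2
    exact (isTop_single 1 n).ne_zero h2
  · have h1 := DFunLike.congr_fun (hlie n m) (ε * (n + m))
    rw [h, hg, hg, gradedMul_single, Finsupp.smul_apply, ← mul_add, Finsupp.single_eq_same,
      Finsupp.single_eq_same, smul_eq_mul, zpow_add, Units.val_mul] at h1
    apply mul_left_cancel₀ (mul_ne_zero (hα n) (hα m))
    linear_combination h1

end classification

/-! ### Rigidity of the structure constants -/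

theorem omega_ne_zero (X : Kind) (lam : OnePoint ℂ) {n m : ℤ} (hm : m ≠ 0) (hnm : n + m ≠ 0) :
    omega X lam n m ≠ 0 := by
  cases X
  · simp only [omega, hm, if_false, add_zero]
    exact_mod_cast hnm
  · simp only [omega, hnm, if_false, sub_zero]
    exact_mod_cast hm

theorem omega_neg_neg (X : Kind) (lam : OnePoint ℂ) {n m : ℤ} (hm : m ≠ 0) (hnm : n + m ≠ 0) :
    omega X lam (-n) (-m) = -omega X lam n m := by
  have hnm' : -n + -m ≠ 0 := by omega
  cases X
  · simp [omega, hm]; ring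
  · simp [omega, hnm, hnm']

theorem omega_B_zero (lam : OnePoint ℂ) (n : ℤ) : omega .B lam n 0 = 0 := by
  rcases eq_or_ne n 0 with rfl | hn
  · simp [omega, defect_zero]
  · simp [omega, hn]

/-- A nonzero `ω n m` links `c m` to `c (n + m)`. All nonzero indices are linked directly; only
index `0` needs care, since `ω` there depends on `λ`. -/
theorem eq_const_of_omega (X : Kind) (lam : OnePoint ℂ) {c : ℤ → ℂ}
    (h : ∀ n m, c m * omega X lam n m = omega X lam n m * c (n + m)) (n : ℤ) : c n = c 0 := by
  have step : ∀ n m, omega X lam n m ≠ 0 → c m = c (n + m) := fun n m hnm =>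
    mul_left_cancel₀ hnm (by rw [← h n m, mul_comm])
  have step' : ∀ n m k, n + m = k → omega X lam n m ≠ 0 → c m = c k := fun n m k hk hnm =>
    hk ▸ step n m hnm
  have hne : ∀ n m, n ≠ 0 → m ≠ 0 → c m = c n := by
    intro n m hn hm
    have := step (n - m) m (omega_ne_zero X lam hm (by omega))
    rwa [sub_add_cancel] at this
  -- For `A` one leaves `X_0` by `L_1` or `L_{-1}`, for `B` one enters it. For finite `λ` one of the
  -- two constants is `±1`; for `λ = ∞` that one vanishes but the other is `±2`.
  obtain ⟨p, hp, hp'⟩ : ∃ p, p ≠ 0 ∧ c p = c 0 := by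
    cases X with
    | A =>
      by_cases h1 : omega .A lam 1 0 = 0
      · refine ⟨-1, by norm_num, (step' (-1) 0 (-1) rfl ?_).symm⟩
        induction lam using OnePoint.rec with
        | infty => norm_num [omega, defect] at h1
        | coe l => simp [omega, defect]
      · exact ⟨1, by norm_num, (step 1 0 h1).symm⟩
    | B =>
      by_cases h1 : omega .B lam 1 (-1) = 0
      · refine ⟨1, by norm_num, step' (-1) 1 0 rfl ?_⟩
        induction lam using OnePoint.rec with
        | infty => norm_num [omega, defect] at h1
        | coe l => simp [omega, defect]
      · exact ⟨-1, by norm_num, step 1 (-1) h1⟩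
  rcases eq_or_ne n 0 with rfl | hn
  · rfl
  · rw [← hp', hne n p hn hp]

theorem one_add_two_mul_sq {l : ℂ} (h : (1 + 2 * l) * (1 + 2 * l) = 1) : l = 0 ∨ l = -1 := by
  have : l * (l + 1) = 0 := by linear_combination h / 4
  rcases mul_eq_zero.1 this with h | h
  · exact Or.inl h
  · exact Or.inr (eq_neg_of_add_eq_zero_left h)

/-- Away from index `0` the constants `ω` are odd under a joint change of sign, so `c` is constant
there. Passing between `X_0` and `X_{±1}` in both directions gives `c 0 = (1+2λ) c 1` and `c 1 =
(1+2λ) c 0`, hence `1+2λ = ±1`. For `λ = ∞` one of the two passages vanishes while its mirror image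
does not. -/
theorem eq_tauCoeff_of_omega (X : Kind) (lam : OnePoint ℂ) {c : ℤ → ℂ} (hc : ∀ n, c n ≠ 0)
    (h : ∀ n m, -c m * omega X lam (-n) (-m) = omega X lam n m * c (n + m)) :
    (lam = ((0 : ℂ) : OnePoint ℂ) ∨ lam = ((-1 : ℂ) : OnePoint ℂ)) ∧
      ∀ n, c n = c 1 * tauCoeff lam n := by
  have hne : ∀ n, n ≠ 0 → c n = c 1 := by
    intro n hn
    have h1 := omega_ne_zero X lam (n := n - 1) one_ne_zero (by omega)
    have h2 := h (n - 1) 1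
    rw [omega_neg_neg X lam one_ne_zero (by omega), sub_add_cancel] at h2
    apply mul_left_cancel₀ h1
    linear_combination -h2
  obtain ⟨hlam, h0⟩ : (lam = ((0 : ℂ) : OnePoint ℂ) ∨ lam = ((-1 : ℂ) : OnePoint ℂ)) ∧
      c 0 = c 1 * tauCoeff lam 0 := by
    have hm1 := hne (-1) (by norm_num)
    induction lam using OnePoint.rec with
    | infty =>
      exfalso
      cases X with
      | A =>
        have h1 := h 1 0
        norm_num [omega, defect] at h1
        exact hc 1 h1
      | B =>
        have h1 := h 1 (-1)
        norm_num [omega, defect] at h1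
        exact hc 0 h1
    | coe l =>
      have key : c 0 = (1 + 2 * l) * c 1 ∧ c 1 = (1 + 2 * l) * c 0 := by
        cases X with
        | A =>
          have h1 := h 1 0
          have h2 := h (-1) 0
          norm_num [omega, defect] at h1 h2
          rw [hm1] at h2
          exact ⟨by linear_combination h1, by linear_combination -h2⟩
        | B =>
          have h1 := h 1 (-1)
          have h2 := h (-1) 1
          norm_num [omega, defect] at h1 h2
          rw [hm1] at h1
          exact ⟨by linear_combination -h2, by linear_combination -h1⟩
      have hsq : (1 + 2 * l) * (1 + 2 * l) = 1 := by
        apply mul_right_cancel₀ (hc 1)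
        linear_combination -key.2 - (1 + 2 * l) * key.1
      rcases one_add_two_mul_sq hsq with rfl | rfl
      · refine ⟨Or.inl rfl, ?_⟩
        rw [tauCoeff, if_neg (by rw [OnePoint.coe_eq_coe]; norm_num)]
        linear_combination key.1
      · refine ⟨Or.inr rfl, ?_⟩
        rw [tauCoeff, if_pos ⟨rfl, rfl⟩]
        linear_combination key.1
  refine ⟨hlam, fun n => ?_⟩
  rcases eq_or_ne n 0 with rfl | hn
  · exact h0
  · rw [hne n hn, tauCoeff, if_neg (fun h => hn h.2), mul_one]

/-! ### Weight-zero cocycles -/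

/-- The functional equation determines `δ` from its values at `1` and `-1`: the pair `(1,-1)` gives
`δ 0`, the pair `(-1,2)` gives `δ 2` (the pair `(1,1)` is void), and `(1,k)` gives `δ (k+1)` for `k
≥ 2`. -/
theorem eq_zero_of_quad {δ : ℤ → ℂ}
    (h : ∀ n m : ℤ, ((n : ℂ) + m) * (δ m - δ n) = ((m : ℂ) - n) * δ (n + m)) (h1 : δ 1 = 0)
    (h1' : δ (-1) = 0) (n : ℕ) : δ n = 0 := by
  have h0 : δ 0 = 0 := by
    have := h 1 (-1)
    norm_num at this
    exact this
  have h2 : δ 2 = 0 := by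
    have := h (-1) 2
    norm_num [h1, h1'] at this
    exact this
  have key : ∀ k : ℕ, δ (k + 2 : ℕ) = 0 := by
    intro k
    induction k with
    | zero => exact h2
    | succ k ih =>
      have h3 := h 1 (k + 2 : ℕ)
      rw [ih, h1, sub_zero, mul_zero] at h3
      have h4 : (((k + 2 : ℕ) : ℤ) : ℂ) - ((1 : ℤ) : ℂ) ≠ 0 := by
        rw [sub_ne_zero]
        exact_mod_cast (by omega : k + 2 ≠ 1)
      have h5 := (mul_eq_zero.1 h3.symm).resolve_left h4
      convert h5 using 2
      push_cast
      ring
  match n with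
  | 0 => exact h0
  | 1 => exact h1
  | k + 2 => exact key k

/-- Both `n²` and `n` are solutions, so subtracting the one that interpolates `η` at `±1` reduces to
the vanishing statement. Negative indices follow because the equation is invariant under `n ↦ -n`.
-/
theorem exists_quad {η : ℤ → ℂ}
    (h : ∀ n m : ℤ, ((n : ℂ) + m) * (η m - η n) = ((m : ℂ) - n) * η (n + m)) :
    ∃ a b : ℂ, ∀ n : ℤ, η n = a * (n : ℂ) ^ 2 + b * n := by
  refine ⟨(η 1 + η (-1)) / 2, (η 1 - η (-1)) / 2, fun n => ?_⟩
  rw [← sub_eq_zero]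
  set δ : ℤ → ℂ := fun n =>
    η n - ((η 1 + η (-1)) / 2 * (n : ℂ) ^ 2 + (η 1 - η (-1)) / 2 * n) with hδ
  have hrel : ∀ n m : ℤ, ((n : ℂ) + m) * (δ m - δ n) = ((m : ℂ) - n) * δ (n + m) := by
    intro n m
    simp only [hδ]
    push_cast
    linear_combination h n m
  have h1 : δ 1 = 0 := by simp only [hδ]; push_cast; ring
  have h1' : δ (-1) = 0 := by simp only [hδ]; push_cast; ring
  change δ n = 0
  obtain ⟨k, rfl | rfl⟩ := Int.eq_nat_or_neg n
  · exact eq_zero_of_quad hrel h1 h1' k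
  · refine eq_zero_of_quad (δ := fun n => δ (-n)) (fun n m => ?_) h1' (by simpa using h1) k
    have := hrel (-n) (-m)
    rw [neg_add]
    push_cast at this
    linear_combination -this

/-- The cocycles of weight zero with values in `X(λ)`. -/
abbrev IsCocycle (X : Kind) (lam : OnePoint ℂ) (γ : ℤ → ℂ) : Prop :=
  ∀ n m, omega X lam n m * γ m - omega X lam m n * γ n = ((m : ℂ) - n) * γ (n + m)

/-- For `A` the cocycle identity becomes the quadratic equation once `γ 0 = 0` is known. For `B` it
becomes that equation for `n γ(n)`, after multiplication by `n + m`. -/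
theorem IsCocycle.exists_coeff {X : Kind} {lam : OnePoint ℂ} {γ : ℤ → ℂ}
    (hγ : IsCocycle X lam γ) :
    ∃ a b, ∀ n, γ n = phiCoeff X lam a n + psiCoeff X lam b n := by
  cases X with
  | A =>
    have h0 : γ 0 = 0 := by
      -- These two instances say `ω(1,0) γ(0) = 0` and `ω(-1,0) γ(0) = 0`. The first constant is `2`
      -- for `λ = ∞`, the second is `-1` for finite `λ`.
      have h1 := hγ 0 1
      have h2 := hγ 0 (-1)
      induction lam using OnePoint.rec with
      | infty =>
        norm_num [omega, defect] at h1
        exact h1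
      | coe l =>
        norm_num [omega, defect] at h2
        exact h2
    obtain ⟨a, b, h⟩ := exists_quad (η := γ) fun n m => by
      have := hγ n m
      rw [omega_mul_zero_coeff lam _ h0, omega_mul_zero_coeff lam _ h0] at this
      linear_combination this
    exact ⟨a, b, h⟩
  | B =>
    obtain ⟨a, b, h⟩ := exists_quad (η := fun n => n * γ n) fun n m => by
      by_cases hs : n + m = 0
      · rw [hs]
        have hs' : (n : ℂ) + m = 0 := by exact_mod_cast hs
        rw [hs']
        simp
      · have := hγ n m
        simp only [omega, hs, add_comm m n, if_false, sub_zero] at this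
        push_cast
        linear_combination ((n : ℂ) + m) * this
    have hne : ∀ n : ℤ, n ≠ 0 → γ n = b + a * n := by
      intro n hn
      have hn' : (n : ℂ) ≠ 0 := by exact_mod_cast hn
      apply mul_left_cancel₀ hn'
      rw [h n]
      ring
    have e1 := hne 1 (by norm_num)
    have e2 := hne (-1) (by norm_num)
    have e3 := hne 2 (by norm_num)
    have e4 := hne (-2) (by norm_num)
    -- Division by `n` says nothing about `γ 0`. The pairs `(1,-1)` and `(2,-2)` each compute it;
    -- for finite `λ` their agreement forces `λ a = 0`, and for `λ = ∞` it forces `a = 0`. So the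
    -- linear term survives only for `λ = 0`.
    have h1 := hγ 1 (-1)
    have h2 := hγ 2 (-2)
    rw [e1, e2] at h1
    rw [e3, e4] at h2
    refine ⟨b, a, fun n => ?_⟩
    have key : γ 0 = phiCoeff .B lam b 0 ∧ ∀ n : ℤ, psiCoeff .B lam a n = a * n := by
      induction lam using OnePoint.rec with
      | infty =>
        norm_num [omega, defect] at h1 h2
        have ha : a = 0 := by linear_combination h2 / 12 + h1 / 3
        subst ha
        exact ⟨by simp [phiCoeff]; linear_combination -h1, by simp [psiCoeff]⟩
      | coe l =>
        norm_num [omega, defect] at h1 h2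
        have ha : l * a = 0 := by linear_combination h2 / 12 - h1 / 6
        constructor
        · simp [phiCoeff]; linear_combination h1 / 2 - ha
        · intro n
          by_cases hl : l = 0
          · subst hl; simp [psiCoeff]
          · rw [(mul_eq_zero.1 ha).resolve_left hl]
            simp [psiCoeff]
    rw [key.2]
    rcases eq_or_ne n 0 with rfl | hn
    · rw [key.1]; simp
    · rw [hne n hn]; simp [phiCoeff, hn]

/-! ### Inner automorphisms -/

section inner

variable (X : Kind) (lam : OnePoint ℂ)

/-- The automorphism `exp(ad(∑ y_i X_i)) = 1 + ad(∑ y_i X_i)`. -/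
def innerAut (y : ℤ →₀ ℂ) : AutWX X lam where
  toFun z := z + ⁅vSum X lam y, z⁆
  map_add' z z' := by rw [lie_add]; abel
  map_smul' c z := by rw [lie_smul, smul_add, RingHom.id_apply]
  map_lie' {z z'} := by
    change ⁅z, z'⁆ + ⁅vSum X lam y, ⁅z, z'⁆⁆ = ⁅z + ⁅vSum X lam y, z⁆, z' + ⁅vSum X lam y, z'⁆⁆
    have h : ⁅⁅vSum X lam y, z⁆, ⁅vSum X lam y, z'⁆⁆ = 0 :=
      lie_eq_zero (by rw [rightC_lie, rightC_vSum, gradedMul_zero_left])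
        (by rw [rightC_lie, rightC_vSum, gradedMul_zero_left])
    rw [lie_add, add_lie, add_lie, h, leibniz_lie (vSum X lam y) z z']
    abel
  invFun z := z - ⁅vSum X lam y, z⁆
  left_inv z := by
    have h : ⁅vSum X lam y, ⁅vSum X lam y, z⁆⁆ = 0 :=
      lie_eq_zero (rightC_vSum y) (by rw [rightC_lie, rightC_vSum, gradedMul_zero_left])
    change z + ⁅vSum X lam y, z⁆ - ⁅vSum X lam y, z + ⁅vSum X lam y, z⁆⁆ = z
    rw [lie_add, h]
    abel
  right_inv z := by
    have h : ⁅vSum X lam y, ⁅vSum X lam y, z⁆⁆ = 0 :=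
      lie_eq_zero (rightC_vSum y) (by rw [rightC_lie, rightC_vSum, gradedMul_zero_left])
    change z - ⁅vSum X lam y, z⁆ + ⁅vSum X lam y, z - ⁅vSum X lam y, z⁆⁆ = z
    rw [lie_sub, h]
    abel

variable {X lam}

theorem innerAut_apply (y : ℤ →₀ ℂ) (z : WX X lam) :
    innerAut X lam y z = z + ⁅vSum X lam y, z⁆ := rfl

theorem innerAut_apply_of_rightC (y : ℤ →₀ ℂ) {z : WX X lam} (hz : rightC z = 0) :
    innerAut X lam y z = z := by
  rw [innerAut_apply, lie_eq_zero (rightC_vSum y) hz, add_zero]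

theorem rightC_innerAut (y : ℤ →₀ ℂ) (z : WX X lam) :
    rightC (innerAut X lam y z) = rightC z := by
  rw [innerAut_apply, map_add, rightC_lie, rightC_vSum, gradedMul_zero_left, add_zero]

theorem leftC_innerAut (y : ℤ →₀ ℂ) (z : WX X lam) :
    leftC (innerAut X lam y z) = leftC z - gradedMul (omega X lam) (rightC z) y := by
  rw [innerAut_apply, map_add, leftC_lie, rightC_vSum, gradedMul_zero_left, leftC_vSum, zero_sub,
    sub_eq_add_neg]

theorem innerAut_add (y z : ℤ →₀ ℂ) :
    innerAut X lam (y + z) = innerAut X lam y * innerAut X lam z :=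
  LieEquiv.ext fun x => by
    rw [mul_apply]
    apply wx_ext
    · simp only [rightC_innerAut]
    · simp only [rightC_innerAut, leftC_innerAut, map_add]
      abel

variable (X lam) in
/-- `y ↦ exp(ad(∑ y_i X_i))` as a homomorphism. -/
def innerHom : Multiplicative (ℤ →₀ ℂ) →* AutWX X lam :=
  MonoidHom.mk' (fun y => innerAut X lam y.toAdd) fun y z => innerAut_add y.toAdd z.toAdd

theorem isExpAd_innerAut (y : ℤ →₀ ℂ) : IsExpAd (vSum X lam y) (innerAut X lam y) := by
  have h2 : ∀ (n : ℕ) (z : WX X lam), ((LieAlgebra.ad ℂ _ (vSum X lam y)) ^ (n + 2)) z = 0 := by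
    intro n z
    have h : ⁅vSum X lam y, ⁅vSum X lam y, z⁆⁆ = 0 :=
      lie_eq_zero (rightC_vSum y) (by rw [rightC_lie, rightC_vSum, gradedMul_zero_left])
    rw [pow_add, pow_two, Module.End.mul_apply, Module.End.mul_apply, LieAlgebra.ad_apply,
      LieAlgebra.ad_apply, h, map_zero]
  refine ⟨fun z => ⟨2, h2 0 z⟩, fun z => ?_⟩
  rw [finsum_eq_sum_of_support_subset (s := Finset.range 2)]
  · rw [Finset.sum_range_succ, Finset.sum_range_one]
    simp only [Nat.factorial, Nat.cast_one, inv_one, one_smul, pow_zero, pow_one,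
      mul_one, Module.End.one_apply, LieAlgebra.ad_apply]
    exact innerAut_apply y z
  · intro n hn
    by_contra h
    rw [Finset.coe_range, Set.mem_Iio, not_lt] at h
    obtain ⟨m, rfl⟩ := Nat.exists_eq_add_of_le' h
    exact hn ((congrArg _ (h2 m z)).trans (smul_zero _))

theorem isExpAd_unique {x : WX X lam} {σ σ' : AutWX X lam} (h : IsExpAd x σ) (h' : IsExpAd x σ') :
    σ = σ' :=
  LieEquiv.ext fun y => (h.2 y).trans (h'.2 y).symm

/-- If the Witt part of `x` is nonzero, leading terms show that no power of `ad x` kills a suitable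
`L_m`. -/
theorem rightC_eq_zero_of_isLocNilp {x : WX X lam} (h : IsLocNilp x) : rightC x = 0 := by
  by_contra hx
  -- The end of the support is chosen so that its degree points outwards or is zero. Starting from
  -- `L_{N+δ}`, the `j`-th iterate has extreme degree `jN + N + δ`, which never equals `N` because
  -- `δ(jN + δ) ≥ 1`; so no leading coefficient vanishes.
  obtain ⟨δ, N, hδ, hN, hpos⟩ : ∃ δ N : ℤ, δ * δ = 1 ∧ IsTop δ (rightC x) N ∧ 0 ≤ δ * N := by
    obtain ⟨N, hN⟩ := exists_isTop 1 hx
    obtain ⟨M, hM⟩ := exists_isTop (-1) hx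
    by_cases h0 : 0 ≤ N
    · exact ⟨1, N, by norm_num, hN, by linarith⟩
    · have := hN.2 M hM.1
      exact ⟨-1, M, by norm_num, hM, by linarith⟩
  have hδ0 : δ ≠ 0 := by rintro rfl; simp at hδ
  have key : ∀ j : ℕ, IsTop δ (rightC (((LieAlgebra.ad ℂ _ x) ^ j) (vL X lam (N + δ))))
      (j * N + (N + δ)) := by
    intro j
    induction j with
    | zero => simpa using isTop_single δ (N + δ)
    | succ j ih =>
      rw [pow_succ', Module.End.mul_apply, LieAlgebra.ad_apply, rightC_lie]
      have e : ((j + 1 : ℕ) : ℤ) * N + (N + δ) = N + (j * N + (N + δ)) := by push_cast; ring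
      rw [e]
      refine IsTop.gradedMul hδ0 hN ih (wittCoeff_ne_zero fun h => ?_)
      have h1 : δ * (j * N + δ) = 0 := by
        rw [show (j : ℤ) * N + δ = 0 by linarith, mul_zero]
      have h2 : 0 ≤ (j : ℤ) * (δ * N) := mul_nonneg (Int.natCast_nonneg j) hpos
      linarith [show δ * (j * N + δ) = j * (δ * N) + δ * δ by ring]
  obtain ⟨n, hn⟩ := h (vL X lam (N + δ))
  apply (key n).ne_zero
  rw [hn, map_zero]

variable (X lam) in
-- The generators already form a group: each has the form `1 + ad_x` with `x` in the abelian ideal,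
-- and these compose additively in `x`.
theorem innAut_eq_range : innAut (WX X lam) = (innerHom X lam).range := by
  apply le_antisymm
  · rw [innAut, Subgroup.closure_le]
    rintro σ ⟨x, hx⟩
    refine ⟨Multiplicative.ofAdd (leftC x), ?_⟩
    have h := isExpAd_innerAut (X := X) (lam := lam) (leftC x)
    rw [vSum_leftC (rightC_eq_zero_of_isLocNilp hx.1)] at h
    exact isExpAd_unique h hx
  · rintro _ ⟨y, rfl⟩
    exact Subgroup.subset_closure ⟨_, isExpAd_innerAut y.toAdd⟩

theorem conj_innerAut (σ : AutWX X lam) (y : ℤ →₀ ℂ) :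
    σ * innerAut X lam y * σ⁻¹ = innerAut X lam (leftC (σ (vSum X lam y))) :=
  LieEquiv.ext fun z => by
    rw [mul_apply, mul_apply, innerAut_apply, innerAut_apply, map_add, LieEquiv.map_lie,
      aut_apply_inv_self, vSum_leftC (rightC_aut_eq_zero σ (rightC_vSum y))]

variable (X lam) in
theorem innAut_normal : (innAut (WX X lam)).Normal := by
  rw [innAut_eq_range]
  refine ⟨?_⟩
  rintro _ ⟨y, rfl⟩ σ
  exact ⟨Multiplicative.ofAdd (leftC (σ (vSum X lam y.toAdd))), (conj_innerAut σ y.toAdd).symm⟩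

/-- On `𝒲_B(λ)` the coordinate of `B_0` does not matter, as `B_0` is central. -/
theorem innerAut_single_zero (lam : OnePoint ℂ) (t : ℂ) :
    innerAut .B lam (Finsupp.single 0 t) = 1 := by
  refine aut_ext (fun n => ?_) fun n => innerAut_apply_of_rightC _ (rightC_vX n)
  rw [innerAut_apply, vSum_single, smul_lie, lie_vX_vL, omega_B_zero, zero_smul, neg_zero,
    smul_zero, add_zero, one_apply]

/-- The condition `y_0 = 0` if `X = B`, which makes `y ↦ exp(ad(∑ y_i X_i))` injective. -/
def IsReduced (X : Kind) (y : ℤ →₀ ℂ) : Prop := X = .A ∨ y 0 = 0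

variable (X lam) in
theorem exists_isReduced (y : ℤ →₀ ℂ) :
    ∃ z, IsReduced X z ∧ innerAut X lam z = innerAut X lam y := by
  cases X with
  | A => exact ⟨y, Or.inl rfl, rfl⟩
  | B =>
    refine ⟨y + Finsupp.single 0 (-y 0), Or.inr (by simp), ?_⟩
    rw [innerAut_add, innerAut_single_zero, mul_one]

/-! ### Values of the standard automorphisms -/

theorem sigmaAut_vL (α : ℂˣ) (n : ℤ) :
    sigmaAut X lam α (vL X lam n) = ((α ^ n : ℂˣ) : ℂ) • vL X lam n := linMap_vL _ _ n

theorem sigmaAut_vX (α : ℂˣ) (n : ℤ) :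
    sigmaAut X lam α (vX X lam n) = ((α ^ n : ℂˣ) : ℂ) • vX X lam n := linMap_vX _ _ n

theorem muAut_vL (ξ : ℂˣ) (n : ℤ) : muAut X lam ξ (vL X lam n) = vL X lam n := linMap_vL _ _ n

theorem muAut_vX (ξ : ℂˣ) (n : ℤ) :
    muAut X lam ξ (vX X lam n) = (ξ : ℂ) • vX X lam n := linMap_vX _ _ n

theorem shiftAut_vL (γ : ℤ → ℂ) (hγ) (n : ℤ) :
    shiftAut X lam γ hγ (vL X lam n) = vL X lam n + γ n • vX X lam n := linMap_vL _ _ n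

theorem shiftAut_vX (γ : ℤ → ℂ) (hγ) (n : ℤ) :
    shiftAut X lam γ hγ (vX X lam n) = vX X lam n := linMap_vX _ _ n

/-- The values of `λ` for which `τ_λ` is not the identity. -/
abbrev IsSpecial (lam : OnePoint ℂ) : Prop :=
  lam = ((0 : ℂ) : OnePoint ℂ) ∨ lam = ((-1 : ℂ) : OnePoint ℂ)

theorem tauAut_vL (h : IsSpecial lam) (n : ℤ) :
    tauAut X lam (vL X lam n) = -vL X lam (-n) := by
  rw [tauAut, dif_pos h]
  exact linMap_vL _ _ n

theorem tauAut_vX (h : IsSpecial lam) (n : ℤ) :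
    tauAut X lam (vX X lam n) = tauCoeff lam n • vX X lam (-n) := by
  rw [tauAut, dif_pos h]
  exact linMap_vX _ _ n

theorem tauAut_of_not (h : ¬ IsSpecial lam) : tauAut X lam = 1 := dif_neg h

variable (X lam) in
theorem tauAut_mul_self : tauAut X lam * tauAut X lam = 1 := by
  by_cases h : IsSpecial lam
  · apply aut_ext <;> intro n
    · rw [mul_apply, tauAut_vL h, map_neg, tauAut_vL h, neg_neg, neg_neg, one_apply]
    · rw [mul_apply, tauAut_vX h, map_smul, tauAut_vX h, smul_smul, tauCoeff_neg,
        tauCoeff_mul_self, one_smul, neg_neg, one_apply]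
  · rw [tauAut_of_not h, one_mul]

theorem shiftAut_mul (γ γ' : ℤ → ℂ) (hγ hγ' hs) :
    shiftAut X lam γ hγ * shiftAut X lam γ' hγ' = shiftAut X lam (γ + γ') hs := by
  apply aut_ext <;> intro n
  · rw [mul_apply, shiftAut_vL, map_add, map_smul, shiftAut_vL, shiftAut_vX, shiftAut_vL,
      Pi.add_apply, add_smul, add_assoc]
  · rw [mul_apply, shiftAut_vX, shiftAut_vX, shiftAut_vX]

/-! ### Factorisation of automorphisms into standard ones -/

/-- An automorphism that is the identity on `X(λ)` and modulo `X(λ)` is the product of an inner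
automorphism and one of the form `shiftAut`. -/
theorem exists_unipotent (σ : AutWX X lam) (hX : ∀ n, σ (vX X lam n) = vX X lam n)
    (hL : ∀ n, rightC (σ (vL X lam n)) = Finsupp.single n 1) :
    ∃ (y : ℤ →₀ ℂ) (γ : ℤ → ℂ) (hγ : IsCocycle X lam γ),
      innerAut X lam y * σ = shiftAut X lam γ hγ := by
  set x := leftC (σ (vL X lam 0)) with hx
  -- Chosen so that `k y_k` cancels the `X_k`-coordinate of `σ(L_0)`. At `k = 0` the division yields
  -- `0`, and the component along `X_0` cannot be removed since `L_0` kills `X_0`.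
  set y : ℤ →₀ ℂ := Finsupp.onFinset x.support (fun k => x k / k) fun k hk => by
    rw [Finsupp.mem_support_iff]
    rintro h
    exact hk (by rw [h, zero_div]) with hy
  set σ' := innerAut X lam y * σ with hσ'
  have hX' : ∀ n, σ' (vX X lam n) = vX X lam n := by
    intro n
    rw [hσ', mul_apply, hX, innerAut_apply_of_rightC _ (rightC_vX n)]
  have hL' : ∀ n, rightC (σ' (vL X lam n)) = Finsupp.single n 1 := by
    intro n
    rw [hσ', mul_apply, rightC_innerAut, hL]
  have h0 : leftC (σ' (vL X lam 0)) = Finsupp.single 0 (x 0) := by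
    ext k
    rw [hσ', mul_apply, leftC_innerAut, hL, ← hx, Finsupp.sub_apply, gradedMul_single_apply,
      omega_zero_left, sub_zero, one_mul, hy, Finsupp.onFinset_apply]
    rcases eq_or_ne k 0 with rfl | hk
    · simp
    · have hk' : (k : ℂ) ≠ 0 := by exact_mod_cast hk
      rw [Finsupp.single_eq_of_ne hk, div_mul_cancel₀ _ hk', sub_self]
  have hrel : ∀ n m, gradedMul (omega X lam) (Finsupp.single n 1) (leftC (σ' (vL X lam m))) -
      gradedMul (omega X lam) (Finsupp.single m 1) (leftC (σ' (vL X lam n))) =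
        ((m : ℂ) - n) • leftC (σ' (vL X lam (n + m))) := by
    intro n m
    rw [← hL' n, ← hL' m, ← leftC_lie, ← LieEquiv.map_lie, lie_vL_vL, map_smul, map_smul]
  -- The cocycle identity for `(0, n)` multiplies the `X_k`-coordinate by `k` on one side and by `n`
  -- on the other; the leftover `X_0`-term of `σ'(L_0)` contributes only at `k = n`.
  have hn : ∀ n, leftC (σ' (vL X lam n)) = Finsupp.single n (leftC (σ' (vL X lam n)) n) := by
    intro n
    ext k
    by_cases hk : k = n
    · rw [hk, Finsupp.single_eq_same]
    · have h := DFunLike.congr_fun (hrel 0 n) k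
      rw [h0, Finsupp.sub_apply, gradedMul_single_apply, gradedMul_single_apply, omega_zero_left,
        Finsupp.single_eq_of_ne (by omega), Finsupp.smul_apply, zero_add, smul_eq_mul,
        sub_zero] at h
      have h2 : (k : ℂ) - n ≠ 0 := by
        rw [sub_ne_zero]; exact_mod_cast hk
      rw [Finsupp.single_eq_of_ne hk]
      apply mul_left_cancel₀ h2
      push_cast at h
      linear_combination h
  refine ⟨y, fun n => leftC (σ' (vL X lam n)) n, fun n m => ?_, ?_⟩
  · have h := DFunLike.congr_fun (hrel n m) (n + m)
    rw [hn n, hn m, gradedMul_single, gradedMul_single, Finsupp.sub_apply, add_comm m n,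
      Finsupp.single_eq_same, Finsupp.single_eq_same, Finsupp.smul_apply, smul_eq_mul] at h
    linear_combination h
  · apply aut_ext <;> intro n
    · rw [shiftAut_vL]
      apply wx_ext
      · rw [hL', map_add, map_smul, rightC_vX, smul_zero, add_zero, rightC_vL]
      · rw [map_add, map_smul, leftC_vX, leftC_vL, zero_add, Finsupp.smul_single_one]
        exact hn n
    · rw [hX', shiftAut_vX]

/-- A subgroup containing the standard automorphisms is the whole group. -/
theorem eq_top_of_mem (S : Subgroup (AutWX X lam)) (hi : ∀ y, innerAut X lam y ∈ S)
    (hs : ∀ γ (hγ : IsCocycle X lam γ), shiftAut X lam γ hγ ∈ S)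
    (hσ : ∀ α, sigmaAut X lam α ∈ S) (hμ : ∀ ξ, muAut X lam ξ ∈ S) (hτ : tauAut X lam ∈ S) :
    S = ⊤ := by
  have key : ∀ σ : AutWX X lam, (∀ n, σ (vX X lam n) = vX X lam n) →
      (∀ n, rightC (σ (vL X lam n)) = Finsupp.single n 1) → σ ∈ S := by
    intro σ h1 h2
    obtain ⟨y, γ, hγ, h⟩ := exists_unipotent σ h1 h2
    rw [← inv_mul_eq_iff_eq_mul.2 h.symm]
    exact S.mul_mem (S.inv_mem (hi y)) (hs γ hγ)
  rw [Subgroup.eq_top_iff']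
  intro σ
  obtain ⟨ε, α, hε, hL⟩ := exists_rightC_aut σ
  obtain ⟨c, hc0, hX, hc⟩ := exists_leftC_aut_vX σ hε hL
  -- `P` is the product of standard automorphisms that agrees with `σ` on the ideal and modulo the
  -- ideal, so that `P⁻¹ σ` is unipotent.
  obtain ⟨P, hP, hPX, hPL⟩ : ∃ P ∈ S, (∀ n, P (vX X lam n) = σ (vX X lam n)) ∧
      ∀ n, rightC (P (vL X lam n)) = rightC (σ (vL X lam n)) := by
    rcases hε with rfl | rfl
    · have hc' := eq_const_of_omega X lam (c := c) fun n m => by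
        have := hc n m
        rw [one_mul, one_mul] at this
        push_cast at this
        rw [← this, one_mul]
      refine ⟨sigmaAut X lam α * muAut X lam (Units.mk0 (c 0) (hc0 0)),
        S.mul_mem (hσ _) (hμ _), fun n => ?_, fun n => ?_⟩
      · rw [mul_apply, muAut_vX, map_smul, sigmaAut_vX, smul_smul, Units.val_mk0, hX, one_mul,
          hc' n]
      · rw [mul_apply, muAut_vL, sigmaAut_vL, hL, map_smul, rightC_vL, Finsupp.smul_single_one,
          one_mul, Int.cast_one, one_mul]
    · obtain ⟨hlam, hc'⟩ := eq_tauCoeff_of_omega X lam hc0 fun n m => by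
        have := hc n m
        simp only [neg_one_mul] at this
        rw [← this]
        push_cast
        ring
      refine ⟨tauAut X lam * (sigmaAut X lam α * muAut X lam (Units.mk0 (c 1) (hc0 1))),
        S.mul_mem hτ (S.mul_mem (hσ _) (hμ _)), fun n => ?_, fun n => ?_⟩
      · rw [mul_apply, mul_apply, muAut_vX, map_smul, sigmaAut_vX, map_smul, map_smul,
          tauAut_vX hlam, smul_smul, smul_smul, Units.val_mk0, hX, hc' n, neg_one_mul]
        congr 1
        ring
      · rw [mul_apply, mul_apply, muAut_vL, sigmaAut_vL, hL, map_smul, tauAut_vL hlam, map_smul,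
          map_neg, rightC_vL, smul_neg, Finsupp.smul_single_one, neg_one_mul, ← Finsupp.single_neg]
        push_cast
        rw [neg_one_mul]
  have hPX' : ∀ x, rightC x = 0 → P x = σ x := by
    intro x hx
    rw [← vSum_leftC hx]
    induction leftC x using Finsupp.induction_linear with
    | zero => rw [vSum, Finsupp.sum_zero_index, map_zero, map_zero]
    | add y z hy hz => rw [vSum_add, map_add, map_add, hy, hz]
    | single n a => rw [vSum_single, map_smul, map_smul, hPX]
  have : P⁻¹ * σ ∈ S := by
    apply key <;> intro n
    · rw [mul_apply, ← hPX, aut_inv_apply_self]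
    · have h : rightC (σ (vL X lam n) - P (vL X lam n)) = 0 := by
        rw [map_sub, hPL, sub_self]
      have h' := rightC_aut_eq_zero P⁻¹ h
      rw [map_sub, aut_inv_apply_self, map_sub, rightC_vL, sub_eq_zero] at h'
      rw [mul_apply, h']
  have h := S.mul_mem hP this
  rwa [mul_inv_cancel_left] at h

end inner

/-! ### Abstract semidirect products -/

section group

/-- The homomorphism `k ↦ t^k` for an element `t` with `t² = 1`. -/
def powHom {Q : Type*} [Group Q] (t : Q) (ht : t * t = 1) : Multiplicative (ZMod 2) →* Q :=
  MonoidHom.mk' (fun k => t ^ k.toAdd.val) fun k l => by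
    change t ^ (k.toAdd + l.toAdd).val = t ^ k.toAdd.val * t ^ l.toAdd.val
    rw [← pow_add, ZMod.val_add]
    exact (pow_eq_pow_mod _ (by rw [pow_two, ht])).symm

theorem powHom_apply {Q : Type*} [Group Q] (t : Q) (ht : t * t = 1) (k : ZMod 2) :
    powHom t ht (Multiplicative.ofAdd k) = t ^ k.val := rfl

theorem zmod_two_cases (k : ZMod 2) : k = 0 ∨ k = 1 := by
  revert k
  decide

/-- Two homomorphisms onto a normal subgroup and a complement of it assemble to an isomorphism
from a semidirect product. -/
theorem exists_semidirect {Q N Γ : Type*} [Group Q] [Group N] [Group Γ] (ρ : N →* Q) (f : Γ →* Q)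
    (hn : ρ.range.Normal) (hinj : ∀ y g, ρ y * f g = 1 → y = 1 ∧ g = 1)
    (hsurj : ρ.range ⊔ f.range = ⊤) :
    Subgroup.IsComplement' ρ.range f.range ∧
    ∃ (θ : Γ →* MulAut N) (e : (N ⋊[θ] Γ) ≃* Q), (∀ y g, e ⟨y, g⟩ = ρ y * f g) ∧
      (∀ g y, ρ (θ g y) = f g * ρ y * (f g)⁻¹) ∧
      SemidirectProduct.inl.range.map e.toMonoidHom = ρ.range := by
  have hρ : Function.Injective ρ := by
    rw [injective_iff_map_eq_one]
    intro y hy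
    exact (hinj y 1 (by rw [hy, map_one, one_mul])).1
  have hmul : ∀ q : Q, ∃ y g, ρ y * f g = q := by
    intro q
    have hq : q ∈ ((ρ.range ⊔ f.range : Subgroup Q) : Set Q) := by rw [hsurj]; trivial
    rw [Subgroup.normal_mul] at hq
    obtain ⟨_, ⟨y, rfl⟩, _, ⟨g, rfl⟩, h⟩ := hq
    exact ⟨y, g, h⟩
  constructor
  · apply Subgroup.isComplement'_of_disjoint_and_mul_eq_univ
    · rw [Subgroup.disjoint_def]
      rintro _ ⟨y, rfl⟩ ⟨g, hg⟩
      rw [(hinj y g⁻¹ (by rw [map_inv, hg, mul_inv_cancel])).1, map_one]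
    · rw [Set.eq_univ_iff_forall]
      intro q
      obtain ⟨y, g, h⟩ := hmul q
      exact ⟨_, ⟨y, rfl⟩, _, ⟨g, rfl⟩, h⟩
  · let i := MonoidHom.ofInjective hρ
    -- Conjugation by `f g` on the normal subgroup, transported to `N` along the isomorphism of `N`
    -- with the range of `ρ`.
    let θ : Γ →* MulAut N :=
      (MulAut.congr i.symm).toMonoidHom.comp ((MulAut.conjNormal (H := ρ.range)).comp f)
    have hθ : ∀ g y, ρ (θ g y) = f g * ρ y * (f g)⁻¹ := by
      intro g y
      rw [← MonoidHom.ofInjective_apply hρ]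
      change ((i (i.symm (MulAut.conjNormal (f g) (i y))) : ρ.range) : Q) = _
      rw [MulEquiv.apply_symm_apply, MulAut.conjNormal_apply]
      rfl
    let F : (N ⋊[θ] Γ) →* Q := SemidirectProduct.lift ρ f fun g => by
      ext y
      exact hθ g y
    have hF : ∀ y g, F ⟨y, g⟩ = ρ y * f g := fun _ _ => rfl
    have hbij : Function.Bijective F := by
      constructor
      · rw [injective_iff_map_eq_one]
        rintro ⟨y, g⟩ h
        obtain ⟨rfl, rfl⟩ := hinj y g h
        rfl
      · intro q
        obtain ⟨y, g, h⟩ := hmul q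
        exact ⟨⟨y, g⟩, h⟩
    have F_inl : ∀ y, F (SemidirectProduct.inl y) = ρ y := fun y => by
      change ρ y * f 1 = ρ y
      rw [map_one, mul_one]
    refine ⟨θ, MulEquiv.ofBijective F hbij, hF, hθ, ?_⟩
    ext q
    constructor
    · rintro ⟨_, ⟨y, rfl⟩, rfl⟩
      exact ⟨y, (F_inl y).symm⟩
    · rintro ⟨y, rfl⟩
      exact ⟨_, ⟨y, rfl⟩, F_inl y⟩

variable (V : Type) [AddCommGroup V] [Module ℂ V]

/-- The action of `ℂˣ × ℂˣ` on `V` by scalar multiplication via the second factor. -/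
def smulHom : ℂˣ × ℂˣ →* MulAut (Multiplicative V) :=
  MonoidHom.mk'
    (fun t => AddEquiv.toMultiplicative (DistribMulAction.toAddEquiv V t.2))
    fun t t' => by
      ext v
      exact mul_smul t.2 t'.2 v.toAdd

variable {V}

/-- The automorphism `(v, α, ξ) ↦ (s v, α⁻¹, ξ)` for an involution `s` of `V`. -/
def flip (s : V →ₗ[ℂ] V) (hs : ∀ v, s (s v) = v) :
    MulAut (Multiplicative V ⋊[smulHom V] (ℂˣ × ℂˣ)) where
  toFun g := ⟨Multiplicative.ofAdd (s g.left.toAdd), (g.right.1⁻¹, g.right.2)⟩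
  invFun g := ⟨Multiplicative.ofAdd (s g.left.toAdd), (g.right.1⁻¹, g.right.2)⟩
  left_inv g := SemidirectProduct.ext (hs _) (Prod.ext (inv_inv _) rfl)
  right_inv g := SemidirectProduct.ext (hs _) (Prod.ext (inv_inv _) rfl)
  map_mul' g g' := by
    refine SemidirectProduct.ext ?_ (Prod.ext (mul_inv _ _) rfl)
    change Multiplicative.ofAdd (s (g.left.toAdd + (g.right.2 : ℂ) • g'.left.toAdd)) =
      Multiplicative.ofAdd (s g.left.toAdd + (g.right.2 : ℂ) • s g'.left.toAdd)
    rw [map_add, map_smul]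

/-- The action of `ℤ/2` on `V ⋊ (ℂˣ × ℂˣ)` by the powers of `flip s`. -/
def flipHom (s : V →ₗ[ℂ] V) (hs : ∀ v, s (s v) = v) :
    Multiplicative (ZMod 2) →* MulAut (Multiplicative V ⋊[smulHom V] (ℂˣ × ℂˣ)) :=
  powHom (flip s hs) (MulEquiv.ext fun g => (flip s hs).left_inv g)

/-- The linear map `s^k`. -/
def involPow (s : V →ₗ[ℂ] V) (k : ZMod 2) (v : V) : V := if k = 0 then v else s v

theorem flipHom_apply (s : V →ₗ[ℂ] V) (hs : ∀ v, s (s v) = v) (k : ZMod 2) (v : V) (α ξ : ℂˣ) :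
    flipHom s hs (Multiplicative.ofAdd k) ⟨Multiplicative.ofAdd v, (α, ξ)⟩ =
      ⟨Multiplicative.ofAdd (involPow s k v), (α ^ sgn k, ξ)⟩ := by
  rcases zmod_two_cases k with rfl | rfl
  · simp [flipHom, involPow, sgn]
  · have h1 : (1 : ZMod 2) ≠ 0 := by decide
    have h2 : (1 : ZMod 2).val = 1 := rfl
    rw [flipHom, powHom_apply, h2, pow_one, involPow, if_neg h1, sgn, if_neg h1, zpow_neg_one]
    rfl

theorem inv_eq_self_zmod_two (k : Multiplicative (ZMod 2)) : k⁻¹ = k := by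
  revert k
  decide

end group

/-! ### The outer part -/

section outer

variable {X : Kind} {lam : OnePoint ℂ}

/-- A complement `V` to the coboundaries in the space of weight-zero cocycles. -/
structure OuterData (X : Kind) (lam : OnePoint ℂ) (V : Type) [AddCommGroup V] [Module ℂ V] where
  coeff : V →ₗ[ℂ] ℤ → ℂ
  cocycle : ∀ v, IsCocycle X lam (coeff v)
  inj : ∀ v t, (X = .A ∨ t = 0) → (∀ n, coeff v n = t * omega X lam n 0) → t = 0 ∧ v = 0
  surj : ∀ γ, IsCocycle X lam γ → ∃ v t, ∀ n, γ n = coeff v n + t * omega X lam n 0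

variable {V : Type} [AddCommGroup V] [Module ℂ V] (D : OuterData X lam V)

/-- The automorphism of `𝒲_X(λ)` given by an element of `V`. -/
def OuterData.shift (v : V) : AutWX X lam := shiftAut X lam (D.coeff v) (D.cocycle v)

theorem OuterData.shift_vL (v : V) (n : ℤ) :
    D.shift v (vL X lam n) = vL X lam n + D.coeff v n • vX X lam n := shiftAut_vL _ _ n

theorem OuterData.shift_vX (v : V) (n : ℤ) : D.shift v (vX X lam n) = vX X lam n :=
  shiftAut_vX _ _ n

theorem OuterData.shift_add (v v' : V) : D.shift (v + v') = D.shift v * D.shift v' := by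
  apply aut_ext <;> intro n
  · rw [mul_apply, D.shift_vL, D.shift_vL, map_add D.coeff, map_add, map_smul, D.shift_vL,
      D.shift_vX, Pi.add_apply, add_smul, add_assoc]
  · rw [mul_apply, D.shift_vX, D.shift_vX, D.shift_vX]

/-- `OuterData.shift` as a homomorphism. -/
def OuterData.shiftHom : Multiplicative V →* AutWX X lam :=
  MonoidHom.mk' (fun v => D.shift v.toAdd) fun v v' => D.shift_add v.toAdd v'.toAdd

variable (X lam) in
/-- `(α, ξ) ↦ σ_α μ_ξ` as a homomorphism. -/
def torusHom : ℂˣ × ℂˣ →* AutWX X lam :=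
  MonoidHom.mk' (fun t => sigmaAut X lam t.1 * muAut X lam t.2) fun t t' => by
    apply aut_ext <;> intro n
    · simp only [mul_apply, muAut_vL, sigmaAut_vL, map_smul, smul_smul, Prod.fst_mul, mul_zpow,
        Units.val_mul]
      congr 1
      ring
    · simp only [mul_apply, muAut_vX, sigmaAut_vX, map_smul, smul_smul, Prod.fst_mul, mul_zpow,
        Units.val_mul, Prod.snd_mul]
      congr 1
      ring

/-- `σ_α` scales `L_n` and `X_n` alike, so it commutes with shifts, while `μ_ξ` scales only the
`X_n`. This is why the torus acts on `V` through `ξ` alone. -/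
theorem OuterData.shift_smul_mul (v : V) (α ξ : ℂˣ) :
    D.shift ((ξ : ℂ) • v) * (sigmaAut X lam α * muAut X lam ξ) =
      sigmaAut X lam α * muAut X lam ξ * D.shift v := by
  apply aut_ext <;> intro n
  · simp only [mul_apply, D.shift_vL, muAut_vL, muAut_vX, sigmaAut_vL, sigmaAut_vX, map_smul,
      map_add, smul_add, smul_smul, Pi.smul_apply, smul_eq_mul]
    congr 2
    ring
  · simp only [mul_apply, D.shift_vX, muAut_vX, sigmaAut_vX, map_smul]

/-- `(v, α, ξ) ↦ shift(v) σ_α μ_ξ` as a homomorphism. -/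
def OuterData.baseHom : (Multiplicative V ⋊[smulHom V] (ℂˣ × ℂˣ)) →* AutWX X lam :=
  SemidirectProduct.lift D.shiftHom (torusHom X lam) fun t => MonoidHom.ext fun v =>
    eq_mul_inv_of_mul_eq (D.shift_smul_mul v.toAdd t.1 t.2)

theorem OuterData.baseHom_apply (v : V) (α ξ : ℂˣ) :
    D.baseHom ⟨Multiplicative.ofAdd v, (α, ξ)⟩ =
      D.shift v * (sigmaAut X lam α * muAut X lam ξ) := rfl

/-- `τ_λ` intertwines the shifts by `v` and by `s v`. -/
def OuterData.Intertwines (s : V →ₗ[ℂ] V) : Prop :=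
  ∀ v n, D.coeff (s v) (-n) = -(tauCoeff lam n * D.coeff v n)

/-- Reversing the grading turns `α` into `α⁻¹` and leaves `ξ` alone. The sign in `Intertwines`
arises because `τ_λ` negates the `L_n` but not the generic `X_n`. -/
theorem OuterData.baseHom_flip (h : IsSpecial lam) {s : V →ₗ[ℂ] V} (hs : ∀ v, s (s v) = v)
    (hτ : D.Intertwines s) (g) :
    D.baseHom (flip s hs g) * tauAut X lam = tauAut X lam * D.baseHom g := by
  obtain ⟨v, α, ξ⟩ := g
  change D.shift (s v.toAdd) * (sigmaAut X lam α⁻¹ * muAut X lam ξ) * tauAut X lam =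
    tauAut X lam * (D.shift v.toAdd * (sigmaAut X lam α * muAut X lam ξ))
  apply aut_ext <;> intro n
  · simp only [mul_apply, muAut_vL, sigmaAut_vL, map_smul, D.shift_vL, map_neg, tauAut_vL h,
      map_add, tauAut_vX h, smul_add, smul_smul, inv_zpow, zpow_neg, inv_inv, neg_add, smul_neg,
      hτ v.toAdd n]
    congr 1
    rw [← neg_smul]
    congr 1
    ring
  · simp only [mul_apply, muAut_vX, sigmaAut_vX, map_smul, D.shift_vX, tauAut_vX h, smul_smul,
      inv_zpow, zpow_neg, inv_inv]
    congr 1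
    ring

/-- The homomorphism `(τ^k shift(v) σ_α μ_ξ)` on `(V ⋊ (ℂˣ × ℂˣ)) ⋊ ℤ/2`. -/
def OuterData.fullHom (h : IsSpecial lam) {s : V →ₗ[ℂ] V} (hs : ∀ v, s (s v) = v)
    (hτ : D.Intertwines s) :
    ((Multiplicative V ⋊[smulHom V] (ℂˣ × ℂˣ)) ⋊[flipHom s hs] Multiplicative (ZMod 2)) →*
      AutWX X lam :=
  SemidirectProduct.lift D.baseHom (powHom (tauAut X lam) (tauAut_mul_self X lam)) fun k => by
    refine MonoidHom.ext fun g => ?_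
    change D.baseHom (flipHom s hs k g) =
      powHom (tauAut X lam) (tauAut_mul_self X lam) k * D.baseHom g *
        (powHom (tauAut X lam) (tauAut_mul_self X lam) k)⁻¹
    rcases zmod_two_cases k.toAdd with hk | hk
    · obtain rfl : k = 1 := hk
      simp
    · obtain rfl : k = Multiplicative.ofAdd 1 := hk
      have h2 : (1 : ZMod 2).val = 1 := rfl
      rw [flipHom, powHom_apply, powHom_apply, h2, pow_one, pow_one, eq_mul_inv_iff_mul_eq]
      exact D.baseHom_flip h hs hτ g

theorem OuterData.fullHom_apply (h : IsSpecial lam) {s : V →ₗ[ℂ] V} (hs : ∀ v, s (s v) = v)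
    (hτ : D.Intertwines s) (k : ZMod 2) (g) :
    D.fullHom h hs hτ (SemidirectProduct.inr (Multiplicative.ofAdd k) * SemidirectProduct.inl g) =
      tauAut X lam ^ k.val * D.baseHom g := by
  rw [map_mul, OuterData.fullHom, SemidirectProduct.lift_inr, SemidirectProduct.lift_inl,
    powHom_apply]

/-- The image of `L_0` shows `k u_k = 0`, so only `u_0` remains. The images of the `L_n` then
identify the cocycle of `v` with a multiple of the coboundary `ω(·,0)`, and the two meet trivially.
-/
theorem IsReduced.eq_zero {u : ℤ →₀ ℂ} (hu : IsReduced X u) {v : V}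
    (h : innerAut X lam u * D.shift v = 1) : u = 0 ∧ v = 0 := by
  have hL : ∀ n k, Finsupp.single n (D.coeff v n) k = u (k - n) * omega X lam n (k - n) := by
    intro n k
    have h1 := DFunLike.congr_fun (congrArg leftC (DFunLike.congr_fun h (vL X lam n))) k
    rw [mul_apply, one_apply, leftC_innerAut, D.shift_vL, map_add, map_add, map_smul, map_smul,
      rightC_vL, rightC_vX, leftC_vL, leftC_vX, smul_zero, add_zero, zero_add,
      Finsupp.smul_single_one, Finsupp.sub_apply, gradedMul_single_apply, one_mul,
      Finsupp.zero_apply, sub_eq_zero] at h1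
    exact h1
  have hne : ∀ k, k ≠ 0 → u k = 0 := by
    intro k hk
    have h1 := hL 0 k
    rw [Finsupp.single_eq_of_ne hk, sub_zero, omega_zero_left] at h1
    exact (mul_eq_zero.1 h1.symm).resolve_right (by exact_mod_cast hk)
  obtain ⟨h0, hv⟩ := D.inj v (u 0) hu fun n => by
    have h1 := hL n n
    rwa [Finsupp.single_eq_same, sub_self] at h1
  refine ⟨?_, hv⟩
  ext k
  rcases eq_or_ne k 0 with rfl | hk
  · exact h0
  · exact hne k hk

/-- Inner automorphisms and shifts fix every `X_n`, so the action on the ideal isolates the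
remaining factors: the degree of the image of `X_1` detects `k`, then `X_0` gives `ξ` and `X_1`
gives `α`. -/
theorem eq_zero_of_mul_eq_one {u : ℤ →₀ ℂ} (hu : IsReduced X u) {v : V} {k : ZMod 2}
    (hk : k = 0 ∨ IsSpecial lam) {α ξ : ℂˣ}
    (h : innerAut X lam u * (tauAut X lam ^ k.val *
      (D.shift v * (sigmaAut X lam α * muAut X lam ξ))) = 1) :
    u = 0 ∧ k = 0 ∧ v = 0 ∧ α = 1 ∧ ξ = 1 := by
  have hX : ∀ n, (ξ * ((α ^ n : ℂˣ) : ℂ)) • (tauAut X lam ^ k.val) (vX X lam n) = vX X lam n := by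
    intro n
    have h1 := DFunLike.congr_fun h (vX X lam n)
    simp only [mul_apply, muAut_vX, sigmaAut_vX, map_smul, D.shift_vX, one_apply, smul_smul] at h1
    rwa [innerAut_apply_of_rightC _ (rightC_aut_eq_zero _ (rightC_vX n))] at h1
  obtain rfl : k = 0 := by
    rcases zmod_two_cases k with rfl | rfl
    · rfl
    · exfalso
      have hs := hk.resolve_left (by decide)
      have h1 := DFunLike.congr_fun (congrArg leftC (hX 1)) 1
      rw [show (1 : ZMod 2).val = 1 from rfl, pow_one, tauAut_vX hs, map_smul, map_smul, leftC_vX,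
        leftC_vX, smul_smul, Finsupp.smul_single_one, Finsupp.single_eq_of_ne (by norm_num),
        Finsupp.single_eq_same] at h1
      exact zero_ne_one h1
  have hξ : ∀ n : ℤ, (ξ : ℂ) * ((α ^ n : ℂˣ) : ℂ) = 1 := by
    intro n
    have h1 := DFunLike.congr_fun (congrArg leftC (hX n)) n
    rwa [ZMod.val_zero, pow_zero, one_apply, map_smul, leftC_vX, Finsupp.smul_single_one,
      Finsupp.single_eq_same, Finsupp.single_eq_same] at h1
  obtain rfl : ξ = 1 := by
    have := hξ 0
    rw [zpow_zero, Units.val_one, mul_one] at this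
    exact Units.ext this
  obtain rfl : α = 1 := by
    have := hξ 1
    rw [zpow_one, Units.val_one, one_mul] at this
    exact Units.ext this
  have h1 : sigmaAut X lam 1 * muAut X lam 1 = 1 := map_one (torusHom X lam)
  rw [h1, mul_one, ZMod.val_zero, pow_zero, one_mul] at h
  obtain ⟨hu0, hv⟩ := hu.eq_zero D h
  exact ⟨hu0, rfl, hv, rfl, rfl⟩

theorem IsReduced.eq_of_innerAut_eq (D : OuterData X lam V) {u u' : ℤ →₀ ℂ} (hu : IsReduced X u) (hu' : IsReduced X u')
    (h : innerAut X lam u = innerAut X lam u') : u = u' := by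
  rw [← sub_eq_zero]
  refine (IsReduced.eq_zero D (u := u - u') (v := 0) ?_ ?_).1
  · rcases hu with hu | hu
    · exact Or.inl hu
    · rcases hu' with hu' | hu'
      · exact Or.inl hu'
      · exact Or.inr (by rw [Finsupp.sub_apply, hu, hu', sub_zero])
  · have h1 : D.shift 0 = 1 := map_one D.shiftHom
    have h2 := innerAut_add (X := X) (lam := lam) (u - u') u'
    rw [sub_add_cancel, h, eq_comm, mul_eq_right] at h2
    rw [h1, h2, mul_one]

/-- Every standard automorphism lies in `S`: a general weight-zero cocycle is one from `V` plus a
coboundary, and the coboundary is realised by an inner automorphism. -/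
theorem range_sup_eq_top (S : Subgroup (AutWX X lam)) (hi : innAut (WX X lam) ≤ S)
    (hD : D.baseHom.range ≤ S) (hτ : tauAut X lam ∈ S) : S = ⊤ := by
  have hi' : ∀ y, innerAut X lam y ∈ S := fun y => hi (by
    rw [innAut_eq_range]
    exact ⟨Multiplicative.ofAdd y, rfl⟩)
  have h1 : ∀ (v : V) (α ξ : ℂˣ), D.shift v * (sigmaAut X lam α * muAut X lam ξ) ∈ S :=
    fun v α ξ => hD ⟨⟨Multiplicative.ofAdd v, (α, ξ)⟩, rfl⟩
  have hs0 : D.shift 0 = 1 := map_one D.shiftHom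
  have hσ1 : sigmaAut X lam 1 = 1 := by
    apply aut_ext <;> intro n
    · rw [sigmaAut_vL, one_zpow, Units.val_one, one_smul, one_apply]
    · rw [sigmaAut_vX, one_zpow, Units.val_one, one_smul, one_apply]
  have hμ1 : muAut X lam 1 = 1 := by
    apply aut_ext <;> intro n
    · rw [muAut_vL, one_apply]
    · rw [muAut_vX, Units.val_one, one_smul, one_apply]
  refine eq_top_of_mem S hi' (fun γ hγ => ?_) (fun α => ?_) (fun ξ => ?_) hτ
  · obtain ⟨v, t, h⟩ := D.surj γ hγ
    -- The sign in `-t` compensates `[X_0, L_n] = -ω(n,0) X_n`.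
    have h2 := S.mul_mem (hi' (Finsupp.single 0 (-t))) (h1 v 1 1)
    rw [hσ1, hμ1, mul_one, mul_one] at h2
    convert h2 using 1
    apply aut_ext <;> intro n
    · rw [mul_apply, shiftAut_vL, D.shift_vL, map_add, map_smul,
        innerAut_apply_of_rightC _ (rightC_vX n), innerAut_apply, vSum_single, smul_lie, lie_vX_vL,
        h n, zero_add, ← neg_smul, smul_smul, add_assoc, ← add_smul]
      congr 2
      ring
    · rw [mul_apply, shiftAut_vX, D.shift_vX, innerAut_apply_of_rightC _ (rightC_vX n)]
  · simpa only [hs0, hμ1, one_mul, mul_one] using h1 0 α 1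
  · simpa only [hs0, hσ1, one_mul, mul_one] using h1 0 1 ξ

end outer

/-! ### The semidirect product decomposition -/

section structure_theorems

variable {X : Kind} {lam : OnePoint ℂ} {V : Type} [AddCommGroup V] [Module ℂ V]
  (D : OuterData X lam V)

/-- Together with `conj_innerAut` this computes the action of the outer part on the coordinates `y`.
-/
theorem leftC_outer_apply {k : ZMod 2} (hk : k = 0 ∨ IsSpecial lam) (v : V) (α ξ : ℂˣ)
    (y : ℤ →₀ ℂ) (i : ℤ) :
    leftC ((tauAut X lam ^ k.val * (D.shift v * (sigmaAut X lam α * muAut X lam ξ)))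
      (vSum X lam y)) i =
      (if k = 0 then 1 else tauCoeff lam i) * ((α ^ (sgn k * i) : ℂˣ) : ℂ) * ξ *
        y (sgn k * i) := by
  induction y using Finsupp.induction_linear with
  | zero =>
    rw [vSum, Finsupp.sum_zero_index, map_zero, map_zero, Finsupp.zero_apply, Finsupp.zero_apply,
      mul_zero]
  | add y z hy hz => rw [vSum_add, map_add, map_add, Finsupp.add_apply, hy, hz, Finsupp.add_apply,
      mul_add]
  | single n a =>
    simp only [vSum_single, mul_apply, muAut_vX, sigmaAut_vX, map_smul, D.shift_vX, smul_smul]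
    rcases zmod_two_cases k with rfl | rfl
    · rw [ZMod.val_zero, pow_zero, one_apply, leftC_vX, if_pos rfl, sgn, if_pos rfl, one_mul,
        one_mul, Finsupp.smul_single_one]
      by_cases hi : i = n
      · rw [hi, Finsupp.single_eq_same, Finsupp.single_eq_same]
        ring
      · rw [Finsupp.single_eq_of_ne hi, Finsupp.single_eq_of_ne hi, mul_zero]
    · have h1 : (1 : ZMod 2) ≠ 0 := by decide
      rw [show (1 : ZMod 2).val = 1 from rfl, pow_one, tauAut_vX (hk.resolve_left h1), map_smul,
        leftC_vX, if_neg h1, sgn, if_neg h1, neg_one_mul, smul_smul, Finsupp.smul_single_one]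
      by_cases hi : -i = n
      · rw [← hi, neg_neg, Finsupp.single_eq_same, Finsupp.single_eq_same, tauCoeff_neg]
        ring
      · rw [Finsupp.single_eq_of_ne (by omega), Finsupp.single_eq_of_ne hi, mul_zero]

variable {N : Type} [AddCommGroup N]

variable (X lam) in
/-- `exp(ad)` on a group `N` of coordinates. -/
def innerCoordHom (j : N →+ CInf) : Multiplicative N →* AutWX X lam :=
  (innerHom X lam).comp (AddMonoidHom.toMultiplicative j)

theorem innerCoordHom_apply (j : N →+ CInf) (y : N) :
    innerCoordHom X lam j (Multiplicative.ofAdd y) = innerAut X lam (j y) := rfl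

theorem innerCoordHom_range {j : N →+ CInf} (hr : ∀ y, IsReduced X y ↔ ∃ z, j z = y) :
    (innerCoordHom X lam j).range = innAut (WX X lam) := by
  rw [innAut_eq_range]
  ext σ
  constructor
  · rintro ⟨y, rfl⟩
    exact ⟨_, rfl⟩
  · rintro ⟨y, rfl⟩
    obtain ⟨z, hz, h⟩ := exists_isReduced X lam y.toAdd
    obtain ⟨n, rfl⟩ := (hr z).1 hz
    exact ⟨Multiplicative.ofAdd n, h⟩

/-- Conjugation replaces `x` by `P x`. Reduced coordinates of an inner automorphism are unique, and
`P x` is again reduced: on `B` its coordinate at `0` is a multiple of the one of `x`. -/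
theorem coord_apply_of_conj {j : N →+ CInf} (hr : ∀ y, IsReduced X y ↔ ∃ z, j z = y) {w z : N}
    {k : ZMod 2} (hk : k = 0 ∨ IsSpecial lam) {v : V} {α ξ : ℂˣ} {P : AutWX X lam}
    (hP : P = tauAut X lam ^ k.val * (D.shift v * (sigmaAut X lam α * muAut X lam ξ)))
    (h : innerAut X lam (j w) = P * innerAut X lam (j z) * P⁻¹) (i : ℤ) :
    j w i = (if k = 0 then 1 else tauCoeff lam i) * ((α ^ (sgn k * i) : ℂˣ) : ℂ) * ξ *
      j z (sgn k * i) := by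
  rw [conj_innerAut] at h
  subst hP
  rw [← leftC_outer_apply D hk v α ξ (j z) i]
  refine DFunLike.congr_fun (IsReduced.eq_of_innerAut_eq D ((hr _).2 ⟨w, rfl⟩) ?_ h) i
  rcases (hr (j z)).2 ⟨z, rfl⟩ with hA | h0
  · exact Or.inl hA
  · refine Or.inr ?_
    rw [leftC_outer_apply D hk, mul_zero, h0, mul_zero]

/-- The case in which `τ_λ` is a genuine involution. `exists_semidirect` applies to `exp(ad)` and to
`D.fullHom`; the first group is normal, the product map has trivial kernel by
`eq_zero_of_mul_eq_one`, and generation is `range_sup_eq_top`. -/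
theorem OuterData.special (h : IsSpecial lam)
    {s : V →ₗ[ℂ] V} (hs : ∀ v, s (s v) = v) (hτ : D.Intertwines s) {j : N →+ CInf}
    (hj : Function.Injective j) (hr : ∀ y, IsReduced X y ↔ ∃ z, j z = y) :
    (∃ G : Subgroup (AutWX X lam), (∀ P, P ∈ G ↔ ∃ (k : ZMod 2) (v : V) (α ξ : ℂˣ),
        P = tauAut X lam ^ k.val * D.shift v * sigmaAut X lam α * muAut X lam ξ) ∧
      Subgroup.IsComplement' (innAut (WX X lam)) G) ∧
    ∃ (θ : ((Multiplicative V ⋊[smulHom V] (ℂˣ × ℂˣ)) ⋊[flipHom s hs] Multiplicative (ZMod 2)) →*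
        MulAut (Multiplicative N))
      (e : (Multiplicative N ⋊[θ]
        ((Multiplicative V ⋊[smulHom V] (ℂˣ × ℂˣ)) ⋊[flipHom s hs] Multiplicative (ZMod 2))) ≃*
          AutWX X lam),
      (∀ (y z : N) (k l : ZMod 2) (v v' : V) (α β ξ ζ : ℂˣ), ∃ w : N,
        (∀ i : ℤ, j w i = j y i + (if k = 0 then 1 else tauCoeff lam i) *
          ((α ^ (sgn k * i) : ℂˣ) : ℂ) * ξ * j z (sgn k * i)) ∧
        (tuple₂ y k v α ξ * tuple₂ z l v' β ζ : Multiplicative N ⋊[θ] _) =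
          tuple₂ w (k + l) (involPow s l v + (ξ : ℂ) • v') (α ^ sgn l * β) (ξ * ζ)) ∧
      (∀ (y : N) (k : ZMod 2) (v : V) (α ξ : ℂˣ), ∃ ρ : AutWX X lam,
        IsExpAd (vSum X lam (j y)) ρ ∧ e (tuple₂ y k v α ξ) =
          ρ * (tauAut X lam ^ k.val * D.shift v * sigmaAut X lam α * muAut X lam ξ)) ∧
      (SemidirectProduct.inl.range).map e.toMonoidHom = innAut (WX X lam) := by
  have hform : ∀ g : (Multiplicative V ⋊[smulHom V] (ℂˣ × ℂˣ)) ⋊[flipHom s hs]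
      Multiplicative (ZMod 2), ∃ (k : ZMod 2) (v : V) (α ξ : ℂˣ),
      g = SemidirectProduct.inr (Multiplicative.ofAdd k) *
        SemidirectProduct.inl ⟨Multiplicative.ofAdd v, (α, ξ)⟩ := by
    intro g
    -- An element of `H ⋊ K` is stored as `h · k`. Since `h · k = k · (k⁻¹ h k)`, its coordinates in
    -- the order `k · h` use the inverse action on `h`.
    generalize hg : (flipHom s hs g.right)⁻¹ g.left = g'
    refine ⟨g.right.toAdd, g'.left.toAdd, g'.right.1, g'.right.2, ?_⟩
    change g = SemidirectProduct.inr g.right * SemidirectProduct.inl g'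
    refine SemidirectProduct.ext ?_ (by simp)
    rw [SemidirectProduct.mul_left, SemidirectProduct.left_inr, SemidirectProduct.right_inr,
      SemidirectProduct.left_inl, one_mul, ← hg, MulAut.apply_inv_self]
  have hf : ∀ (k : ZMod 2) (v : V) (α ξ : ℂˣ), D.fullHom h hs hτ
      (SemidirectProduct.inr (Multiplicative.ofAdd k) *
        SemidirectProduct.inl ⟨Multiplicative.ofAdd v, (α, ξ)⟩) =
      tauAut X lam ^ k.val * (D.shift v * (sigmaAut X lam α * muAut X lam ξ)) :=
    fun k v α ξ => by rw [D.fullHom_apply h hs hτ, D.baseHom_apply]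
  obtain ⟨hc, θ, e, he, hθ, hmap⟩ := exists_semidirect (innerCoordHom X lam j)
    (D.fullHom h hs hτ) (by rw [innerCoordHom_range hr]; exact innAut_normal X lam) (by
      intro y g hyg
      obtain ⟨k, v, α, ξ, rfl⟩ := hform g
      rw [hf] at hyg
      obtain ⟨h1, rfl, rfl, rfl, rfl⟩ :=
        eq_zero_of_mul_eq_one D ((hr _).2 ⟨y.toAdd, rfl⟩) (Or.inr h) hyg
      refine ⟨?_, ?_⟩
      · exact hj (h1.trans (map_zero j).symm)
      · change (SemidirectProduct.inr 1 * SemidirectProduct.inl 1 :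
          (Multiplicative V ⋊[smulHom V] (ℂˣ × ℂˣ)) ⋊[flipHom s hs] Multiplicative (ZMod 2)) = 1
        rw [map_one, map_one, mul_one]) (by
      refine range_sup_eq_top D _ ?_ ?_ ?_
      · rw [← innerCoordHom_range hr]
        exact le_sup_left
      · refine le_trans ?_ le_sup_right
        rintro _ ⟨g, rfl⟩
        exact ⟨SemidirectProduct.inl g, SemidirectProduct.lift_inl _ _ _ g⟩
      · refine Subgroup.mem_sup_right
          ⟨SemidirectProduct.inr (Multiplicative.ofAdd 1) * SemidirectProduct.inl 1, ?_⟩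
        rw [D.fullHom_apply h hs hτ, map_one, mul_one]
        exact pow_one _)
  rw [innerCoordHom_range hr] at hc hmap
  refine ⟨⟨_, fun P => ⟨?_, ?_⟩, hc⟩, θ, e, ?_, ?_, hmap⟩
  · rintro ⟨g, rfl⟩
    obtain ⟨k, v, α, ξ, rfl⟩ := hform g
    exact ⟨k, v, α, ξ, by rw [hf, mul_assoc, mul_assoc]⟩
  · rintro ⟨k, v, α, ξ, rfl⟩
    exact ⟨_, by rw [hf, mul_assoc, mul_assoc]⟩
  · intro y z k l v v' α β ξ ζ
    set g := (SemidirectProduct.inr (Multiplicative.ofAdd k) *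
      SemidirectProduct.inl ⟨Multiplicative.ofAdd v, (α, ξ)⟩ :
      (Multiplicative V ⋊[smulHom V] (ℂˣ × ℂˣ)) ⋊[flipHom s hs] Multiplicative (ZMod 2)) with hg
    -- The normal component of a product is `y` plus the conjugate of `z` by the outer part.
    refine ⟨y + (θ g (Multiplicative.ofAdd z)).toAdd, fun i => ?_, ?_⟩
    · rw [map_add, Finsupp.add_apply,
        coord_apply_of_conj D hr (Or.inr h) (hf k v α ξ) (hθ g (Multiplicative.ofAdd z)) i]
      rfl
    · refine SemidirectProduct.ext rfl ?_
      change g * (SemidirectProduct.inr (Multiplicative.ofAdd l) *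
        SemidirectProduct.inl ⟨Multiplicative.ofAdd v', (β, ζ)⟩) =
        SemidirectProduct.inr (Multiplicative.ofAdd k * Multiplicative.ofAdd l) *
        SemidirectProduct.inl ⟨Multiplicative.ofAdd (involPow s l v + (ξ : ℂ) • v'),
          (α ^ sgn l * β, ξ * ζ)⟩
      -- Moving `τ^l` to the left past `(v, α, ξ)` conjugates by `τ^{-l} = τ^l`; this produces the
      -- `sgn l` in the group law.
      have h1 : (SemidirectProduct.inl ⟨Multiplicative.ofAdd v, (α, ξ)⟩ *
          SemidirectProduct.inr (Multiplicative.ofAdd l) :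
          (Multiplicative V ⋊[smulHom V] (ℂˣ × ℂˣ)) ⋊[flipHom s hs] Multiplicative (ZMod 2)) =
          SemidirectProduct.inr (Multiplicative.ofAdd l) * SemidirectProduct.inl
            ⟨Multiplicative.ofAdd (involPow s l v), (α ^ sgn l, ξ)⟩ := by
        have hl : Multiplicative.ofAdd l * Multiplicative.ofAdd l = 1 := by
          nth_rewrite 1 [← inv_eq_self_zmod_two (Multiplicative.ofAdd l)]
          exact inv_mul_cancel _
        rw [← flipHom_apply s hs l v α ξ, SemidirectProduct.inl_aut, inv_eq_self_zmod_two,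
          ← mul_assoc, ← mul_assoc, ← map_mul, hl, map_one, one_mul]
      have h2 : (⟨Multiplicative.ofAdd (involPow s l v + (ξ : ℂ) • v'),
          (α ^ sgn l * β, ξ * ζ)⟩ : Multiplicative V ⋊[smulHom V] (ℂˣ × ℂˣ)) =
          ⟨Multiplicative.ofAdd (involPow s l v), (α ^ sgn l, ξ)⟩ *
            ⟨Multiplicative.ofAdd v', (β, ζ)⟩ := rfl
      rw [h2, map_mul, map_mul, hg, mul_assoc, ← mul_assoc (SemidirectProduct.inl _), h1]
      simp only [mul_assoc]
  · intro y k v α ξ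
    refine ⟨innerAut X lam (j y), isExpAd_innerAut _, ?_⟩
    rw [tuple₂, he, hf, innerCoordHom_apply, mul_assoc (tauAut X lam ^ k.val * D.shift v),
      mul_assoc (tauAut X lam ^ k.val)]

/-- Here `τ_λ` is the identity, so the factor `ℤ/2` disappears and `D.baseHom` alone is a
complement; the general lemmas are used with `k = 0`. -/
theorem OuterData.generic (h : ¬ IsSpecial lam) {j : N →+ CInf}
    (hj : Function.Injective j) (hr : ∀ y, IsReduced X y ↔ ∃ z, j z = y) :
    (∃ G : Subgroup (AutWX X lam), (∀ P, P ∈ G ↔ ∃ (v : V) (α ξ : ℂˣ),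
        P = D.shift v * sigmaAut X lam α * muAut X lam ξ) ∧
      Subgroup.IsComplement' (innAut (WX X lam)) G) ∧
    ∃ (θ : (Multiplicative V ⋊[smulHom V] (ℂˣ × ℂˣ)) →* MulAut (Multiplicative N))
      (e : (Multiplicative N ⋊[θ] (Multiplicative V ⋊[smulHom V] (ℂˣ × ℂˣ))) ≃* AutWX X lam),
      (∀ (y z : N) (v v' : V) (α β ξ ζ : ℂˣ), ∃ w : N,
        (∀ i : ℤ, j w i = j y i + ((α ^ i : ℂˣ) : ℂ) * ξ * j z i) ∧
        (tuple y v α ξ * tuple z v' β ζ : Multiplicative N ⋊[θ] _) =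
          tuple w (v + (ξ : ℂ) • v') (α * β) (ξ * ζ)) ∧
      (∀ (y : N) (v : V) (α ξ : ℂˣ), ∃ ρ : AutWX X lam,
        IsExpAd (vSum X lam (j y)) ρ ∧ e (tuple y v α ξ) =
          ρ * (D.shift v * sigmaAut X lam α * muAut X lam ξ)) ∧
      (SemidirectProduct.inl.range).map e.toMonoidHom = innAut (WX X lam) := by
  have h0 : ∀ P : AutWX X lam, tauAut X lam ^ (0 : ZMod 2).val * P = P := fun P => by
    rw [ZMod.val_zero, pow_zero, one_mul]
  obtain ⟨hc, θ, e, he, hθ, hmap⟩ := exists_semidirect (innerCoordHom X lam j) D.baseHom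
    (by rw [innerCoordHom_range hr]; exact innAut_normal X lam) (by
      rintro y ⟨v, α, ξ⟩ hyg
      have hyg' : innerAut X lam (j y.toAdd) * (tauAut X lam ^ (0 : ZMod 2).val *
          (D.shift v.toAdd * (sigmaAut X lam α * muAut X lam ξ))) = 1 := by
        rw [h0]
        exact hyg
      obtain ⟨h1, -, h2, rfl, rfl⟩ :=
        eq_zero_of_mul_eq_one D ((hr _).2 ⟨y.toAdd, rfl⟩) (Or.inl rfl) hyg'
      obtain rfl : v = 1 := h2
      exact ⟨hj (h1.trans (map_zero j).symm), rfl⟩) (by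
      refine range_sup_eq_top D _ ?_ le_sup_right ?_
      · rw [← innerCoordHom_range hr]
        exact le_sup_left
      · rw [tauAut_of_not h]
        exact Subgroup.one_mem _)
  rw [innerCoordHom_range hr] at hc hmap
  refine ⟨⟨_, fun P => ⟨?_, ?_⟩, hc⟩, θ, e, ?_, ?_, hmap⟩
  · rintro ⟨⟨v, α, ξ⟩, rfl⟩
    exact ⟨v.toAdd, α, ξ, (mul_assoc _ _ _).symm⟩
  · rintro ⟨v, α, ξ, rfl⟩
    exact ⟨⟨Multiplicative.ofAdd v, (α, ξ)⟩, (mul_assoc _ _ _).symm⟩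
  · intro y z v v' α β ξ ζ
    set g : Multiplicative V ⋊[smulHom V] (ℂˣ × ℂˣ) := ⟨Multiplicative.ofAdd v, (α, ξ)⟩
    refine ⟨y + (θ g (Multiplicative.ofAdd z)).toAdd, fun i => ?_, rfl⟩
    rw [map_add, Finsupp.add_apply, coord_apply_of_conj D hr (Or.inl rfl) (h0 _).symm
      (hθ g (Multiplicative.ofAdd z)) i, if_pos rfl, sgn, if_pos rfl, one_mul, one_mul]
    rfl
  · intro y v α ξ
    exact ⟨innerAut X lam (j y), isExpAd_innerAut _,
      (he _ _).trans (congrArg _ (mul_assoc _ _ _).symm)⟩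

end structure_theorems

/-! ### The individual families -/

section cases

variable (X : Kind) (lam : OnePoint ℂ)

/-- The cocycles of the automorphisms `φ_a`. -/
def phiLin : ℂ →ₗ[ℂ] ℤ → ℂ where
  toFun a := phiCoeff X lam a
  map_add' a b := by
    ext n
    cases X
    · simp [phiCoeff]; ring
    · by_cases hn : n = 0
      · induction lam using OnePoint.rec <;> simp [phiCoeff, hn]
        ring
      · simp [phiCoeff, hn]
  map_smul' c a := by
    ext n
    cases X
    · simp [phiCoeff]; ring
    · by_cases hn : n = 0
      · induction lam using OnePoint.rec <;> simp [phiCoeff, hn]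
        ring
      · simp [phiCoeff, hn]

/-- The cocycles of the automorphisms `ψ_b`. -/
def psiLin : ℂ →ₗ[ℂ] ℤ → ℂ where
  toFun a := psiCoeff X lam a
  map_add' a b := by
    ext n
    cases X
    · simp [psiCoeff]; ring
    · simp only [psiCoeff, Pi.add_apply]; split_ifs <;> ring
  map_smul' c a := by
    ext n
    cases X
    · simp [psiCoeff]; ring
    · simp only [psiCoeff, Pi.smul_apply, RingHom.id_apply, smul_eq_mul]; split_ifs <;> ring

variable {X lam}

theorem phiLin_apply (a : ℂ) : phiLin X lam a = phiCoeff X lam a := rfl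

theorem psiLin_apply (a : ℂ) : psiLin X lam a = psiCoeff X lam a := rfl

/-- The weight-zero cocycles for `A(0)`. -/
def outerA0 : OuterData .A ((0 : ℂ) : OnePoint ℂ) ℂ where
  coeff := phiLin _ _
  cocycle := phiCoeff_cocycle _ _
  inj v t _ h := by
    have h1 := h 1
    have h2 := h (-1)
    simp [phiLin_apply, phiCoeff, omega, defect] at h1 h2
    exact ⟨by linear_combination (h2 - h1) / 2, by linear_combination (h1 + h2) / 2⟩
  surj γ hγ := by
    obtain ⟨a, b, h⟩ := hγ.exists_coeff
    -- For `A(0)` one has `ω(n,0) = n`, so the `ψ`-part is exactly the coboundary.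
    refine ⟨a, b, fun n => ?_⟩
    rw [h, phiLin_apply]
    simp [psiCoeff, omega, defect]

/-- The weight-zero cocycles for `A(λ)`, `λ ≠ 0`. -/
def outerA (hlam : lam ≠ ((0 : ℂ) : OnePoint ℂ)) : OuterData .A lam ℂ where
  coeff := psiLin _ _
  cocycle := psiCoeff_cocycle _ _
  inj v t _ h := by
    have h1 := h 1
    have h2 := h (-1)
    have ht : t = 0 := by
      induction lam using OnePoint.rec with
      | infty =>
        simp [psiLin_apply, psiCoeff, omega, defect] at h1 h2
        rw [h2] at h1
        linear_combination -h1 / 2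
      | coe l =>
        have hl : l ≠ 0 := fun h => hlam (congrArg _ h)
        simp [psiLin_apply, psiCoeff, omega, defect] at h1 h2
        apply mul_left_cancel₀ hl
        linear_combination (-h1 + h2) / 2
    refine ⟨ht, ?_⟩
    rw [ht] at h1
    simpa [psiLin_apply, psiCoeff] using h1
  surj γ hγ := by
    obtain ⟨a, b, h⟩ := hγ.exists_coeff
    induction lam using OnePoint.rec with
    | infty =>
      refine ⟨b - a, a, fun n => ?_⟩
      rw [h, psiLin_apply]
      simp [phiCoeff, psiCoeff, omega, defect]
      ring
    | coe l =>
      have hl : l ≠ 0 := fun h => hlam (congrArg _ h)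
      -- From `ω(n,0) = l n² + (1+l) n`: the multiple `a/l` absorbs the quadratic term `a n²`, and
      -- the linear remainder is a `ψ`-cocycle.
      refine ⟨b - a / l * (1 + l), a / l, fun n => ?_⟩
      rw [h, psiLin_apply]
      simp [phiCoeff, psiCoeff, omega, defect]
      field_simp
      ring

/-- The weight-zero cocycles for `B(0)`. -/
def outerB0 : OuterData .B ((0 : ℂ) : OnePoint ℂ) (ℂ × ℂ) where
  coeff := (phiLin _ _).coprod (psiLin _ _)
  cocycle v n m := by
    have h1 := phiCoeff_cocycle .B ((0 : ℂ) : OnePoint ℂ) v.1 n m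
    have h2 := psiCoeff_cocycle .B ((0 : ℂ) : OnePoint ℂ) v.2 n m
    simp only [LinearMap.coprod_apply, Pi.add_apply, phiLin_apply, psiLin_apply]
    linear_combination h1 + h2
  inj v t ht h := by
    have ht0 : t = 0 := by simpa using ht
    have h1 := h 1
    have h2 := h (-1)
    simp [phiLin_apply, psiLin_apply, phiCoeff, psiCoeff, ht0] at h1 h2
    have e1 : v.1 = 0 := by linear_combination (h1 + h2) / 2
    have e2 : v.2 = 0 := by linear_combination (h1 - h2) / 2
    exact ⟨ht0, Prod.ext e1 e2⟩
  surj γ hγ := by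
    obtain ⟨a, b, h⟩ := hγ.exists_coeff
    exact ⟨(a, b), 0, fun n => by rw [h, zero_mul, add_zero]; rfl⟩

/-- The weight-zero cocycles for `B(λ)`, `λ ≠ 0`. -/
def outerB (hlam : lam ≠ ((0 : ℂ) : OnePoint ℂ)) : OuterData .B lam ℂ where
  coeff := phiLin _ _
  cocycle := phiCoeff_cocycle _ _
  inj v t ht h := by
    have ht0 : t = 0 := by simpa using ht
    have h1 := h 1
    simp [phiLin_apply, phiCoeff, ht0] at h1
    exact ⟨ht0, h1⟩
  surj γ hγ := by
    obtain ⟨a, b, h⟩ := hγ.exists_coeff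
    refine ⟨a, 0, fun n => ?_⟩
    rw [h, zero_mul, psiCoeff, if_neg hlam]
    rfl

theorem varpiAut_zero (a : ℂ) :
    varpiAut ((0 : ℂ) : OnePoint ℂ) a = outerA0.shift a := if_pos rfl

theorem varpiAut_of_ne (hlam : lam ≠ ((0 : ℂ) : OnePoint ℂ)) (a : ℂ) :
    varpiAut lam a = (outerA hlam).shift a := if_neg hlam

theorem phiAut_mul_psiAut_zero (a b : ℂ) :
    phiAut .B ((0 : ℂ) : OnePoint ℂ) a * psiAut .B ((0 : ℂ) : OnePoint ℂ) b =
      outerB0.shift (a, b) := shiftAut_mul _ _ _ _ _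

theorem phiAut_mul_psiAut_of_ne (hlam : lam ≠ ((0 : ℂ) : OnePoint ℂ)) (a b : ℂ) :
    phiAut .B lam a * psiAut .B lam b = (outerB hlam).shift a := by
  have : psiAut .B lam b = 1 := by
    apply aut_ext <;> intro n
    · rw [psiAut, shiftAut_vL, psiCoeff, if_neg hlam, zero_smul, add_zero, one_apply]
    · rw [psiAut, shiftAut_vX, one_apply]
  rw [this, mul_one]
  rfl

theorem neg_one_ne_zero_onePoint : ((-1 : ℂ) : OnePoint ℂ) ≠ ((0 : ℂ) : OnePoint ℂ) := by
  rw [Ne, OnePoint.coe_eq_coe]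
  norm_num

theorem tauCoeff_zero_lam (n : ℤ) : tauCoeff ((0 : ℂ) : OnePoint ℂ) n = 1 :=
  if_neg fun h => neg_one_ne_zero_onePoint h.1.symm

theorem tauCoeff_neg_one_lam (n : ℤ) :
    tauCoeff ((-1 : ℂ) : OnePoint ℂ) n = if n = 0 then -1 else 1 := by
  simp [tauCoeff]

/-- The involution is dictated by parity: away from index `0`, even cocycles are negated and odd
ones are kept. This is the source of the signs `ε₂` in the group laws. -/
theorem intertwines_A0 : outerA0.Intertwines (-LinearMap.id) := fun v n => by
  change phiCoeff .A ((0 : ℂ) : OnePoint ℂ) (-v) (-n) =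
    -(tauCoeff ((0 : ℂ) : OnePoint ℂ) n * phiCoeff .A ((0 : ℂ) : OnePoint ℂ) v n)
  rw [tauCoeff_zero_lam]
  simp [phiCoeff]

theorem intertwines_A : (outerA neg_one_ne_zero_onePoint).Intertwines LinearMap.id := fun v n => by
  change psiCoeff .A ((-1 : ℂ) : OnePoint ℂ) v (-n) =
    -(tauCoeff ((-1 : ℂ) : OnePoint ℂ) n * psiCoeff .A ((-1 : ℂ) : OnePoint ℂ) v n)
  rw [tauCoeff_neg_one_lam]
  rcases eq_or_ne n 0 with rfl | hn
  · simp [psiCoeff]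
  · simp [psiCoeff, hn]

theorem intertwines_B0 :
    outerB0.Intertwines ((-LinearMap.id : ℂ →ₗ[ℂ] ℂ).prodMap LinearMap.id) := fun v n => by
  change phiCoeff _ _ (-v.1) (-n) + psiCoeff _ _ v.2 (-n) =
    -(_ * (phiCoeff _ _ v.1 n + psiCoeff _ _ v.2 n))
  rw [tauCoeff_zero_lam]
  simp [phiCoeff, psiCoeff, add_comm]

/-- At index `0` the sign of `τ_{-1}` is harmless, since the cocycle carries the factor `λ + 1 = 0`
there. -/
theorem intertwines_B :
    (outerB neg_one_ne_zero_onePoint).Intertwines (-LinearMap.id) := fun v n => by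
  change phiCoeff .B ((-1 : ℂ) : OnePoint ℂ) (-v) (-n) =
    -(tauCoeff ((-1 : ℂ) : OnePoint ℂ) n * phiCoeff .B ((-1 : ℂ) : OnePoint ℂ) v n)
  rw [tauCoeff_neg_one_lam]
  rcases eq_or_ne n 0 with rfl | hn
  · simp [phiCoeff]
  · simp [phiCoeff, hn]

theorem isReduced_A (y : ℤ →₀ ℂ) : IsReduced .A y ↔ ∃ z, AddMonoidHom.id CInf z = y :=
  ⟨fun _ => ⟨y, rfl⟩, fun _ => Or.inl rfl⟩

theorem isReduced_B (y : ℤ →₀ ℂ) : IsReduced .B y ↔ ∃ z, CInfZero.subtype z = y := by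
  constructor
  · rintro (h | h)
    · cases h
    · exact ⟨⟨y, h⟩, rfl⟩
  · rintro ⟨z, rfl⟩
    exact Or.inr z.2

theorem involPow_neg_id (l : ZMod 2) (a : ℂ) :
    involPow (-LinearMap.id : ℂ →ₗ[ℂ] ℂ) l a = sgn l * a := by
  by_cases hl : l = 0 <;> simp [involPow, sgn, hl]

theorem involPow_id {V : Type} [AddCommGroup V] [Module ℂ V] (l : ZMod 2) (v : V) :
    involPow LinearMap.id l v = v := by
  by_cases hl : l = 0 <;> simp [involPow, hl]

theorem involPow_prodMap (l : ZMod 2) (a b : ℂ) :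
    involPow ((-LinearMap.id : ℂ →ₗ[ℂ] ℂ).prodMap LinearMap.id) l (a, b) = (sgn l * a, b) := by
  by_cases hl : l = 0 <;> simp [involPow, sgn, hl]

theorem tauAut_pow_of_not (h : ¬ IsSpecial lam) (k : ZMod 2) : tauAut X lam ^ k.val = 1 := by
  rw [tauAut_of_not h, one_pow]

variable (X lam) in
-- The subgroups produced by `OuterData.special` and `OuterData.generic` are matched with the
-- prescribed sets; redundant parameters (`b` on `B(λ)` for `λ ≠ 0`, and `k` for generic `λ`) do not
-- change the automorphism.
theorem exists_complement : ∃ G : Subgroup (AutWX X lam),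
    (G : Set (AutWX X lam)) = outerSet X lam ∧
      Subgroup.IsComplement' (innAut (WX X lam)) G := by
  have hset : ∀ G : Subgroup (AutWX X lam), (∀ P, P ∈ G ↔ P ∈ outerSet X lam) →
      (G : Set (AutWX X lam)) = outerSet X lam := fun G h => Set.ext h
  by_cases h : IsSpecial lam
  · rcases h with rfl | rfl <;> cases X
    · obtain ⟨⟨G, hG, hc⟩, -⟩ :=
        outerA0.special (Or.inl rfl) (fun v => neg_neg v) intertwines_A0
        (j := AddMonoidHom.id CInf) Function.injective_id isReduced_A
      refine ⟨G, hset G fun P => (hG P).trans ?_, hc⟩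
      simp only [outerSet, Set.mem_ofPred_eq, PsiAut, varpiAut_zero]
    · obtain ⟨⟨G, hG, hc⟩, -⟩ :=
        outerB0.special (Or.inl rfl) (fun v => Prod.ext (neg_neg v.1) rfl) intertwines_B0
        (j := CInfZero.subtype) Subtype.val_injective isReduced_B
      refine ⟨G, hset G fun P => (hG P).trans ?_, hc⟩
      simp only [outerSet, Set.mem_ofPred_eq, PhiAut, mul_assoc (tauAut _ _ ^ _) (phiAut _ _ _),
        phiAut_mul_psiAut_zero, Prod.exists]
    · obtain ⟨⟨G, hG, hc⟩, -⟩ :=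
        (outerA neg_one_ne_zero_onePoint).special (Or.inr rfl) (fun _ => rfl) intertwines_A
        (j := AddMonoidHom.id CInf) Function.injective_id isReduced_A
      refine ⟨G, hset G fun P => (hG P).trans ?_, hc⟩
      simp only [outerSet, Set.mem_ofPred_eq, PsiAut, varpiAut_of_ne neg_one_ne_zero_onePoint]
    · obtain ⟨⟨G, hG, hc⟩, -⟩ :=
        (outerB neg_one_ne_zero_onePoint).special (Or.inr rfl) (fun v => neg_neg v) intertwines_B
        (j := CInfZero.subtype) Subtype.val_injective isReduced_B
      refine ⟨G, hset G fun P => (hG P).trans ?_, hc⟩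
      simp only [outerSet, Set.mem_ofPred_eq, PhiAut, mul_assoc (tauAut _ _ ^ _) (phiAut _ _ _),
        phiAut_mul_psiAut_of_ne neg_one_ne_zero_onePoint, exists_const]
  · cases X
    · obtain ⟨⟨G, hG, hc⟩, -⟩ :=
        (outerA fun h0 => h (Or.inl h0)).generic h
        (j := AddMonoidHom.id CInf) Function.injective_id isReduced_A
      refine ⟨G, hset G fun P => (hG P).trans ?_, hc⟩
      simp only [outerSet, Set.mem_ofPred_eq, PsiAut, varpiAut_of_ne fun h0 => h (Or.inl h0),
        tauAut_pow_of_not h, one_mul, exists_const]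
    · obtain ⟨⟨G, hG, hc⟩, -⟩ :=
        (outerB fun h0 => h (Or.inl h0)).generic h
        (j := CInfZero.subtype) Subtype.val_injective isReduced_B
      refine ⟨G, hset G fun P => (hG P).trans ?_, hc⟩
      simp only [outerSet, Set.mem_ofPred_eq, PhiAut, phiAut_mul_psiAut_of_ne fun h0 =>
        h (Or.inl h0), tauAut_pow_of_not h, one_mul, exists_const]

end cases

end

end WittSum

/-! ### The theorem -/

theorem mainTheorem3 :
    (∀ (X : Kind) (lam : OnePoint ℂ),
      (innAut (WX X lam)).Normal ∧
      ∃ G : Subgroup (AutWX X lam), (G : Set (AutWX X lam)) = outerSet X lam ∧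
        Subgroup.IsComplement' (innAut (WX X lam)) G) ∧
    (∃ (θ₁ : ℂˣ × ℂˣ →* MulAut (Multiplicative ℂ))
      (θ₂ : Multiplicative (ZMod 2) →* MulAut (Multiplicative ℂ ⋊[θ₁] (ℂˣ × ℂˣ)))
      (θ₃ : ((Multiplicative ℂ ⋊[θ₁] (ℂˣ × ℂˣ)) ⋊[θ₂] Multiplicative (ZMod 2)) →*
        MulAut (Multiplicative CInf))
      (e : (Multiplicative CInf ⋊[θ₃]
          ((Multiplicative ℂ ⋊[θ₁] (ℂˣ × ℂˣ)) ⋊[θ₂] Multiplicative (ZMod 2))) ≃*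
        AutWX .A ((0 : ℂ) : OnePoint ℂ)),
      (∀ (y z : CInf) (k l : ZMod 2) (a c : ℂ) (α β ξ ζ : ℂˣ),
        ∃ w : CInf,
          (∀ i : ℤ, w i = y i +
            ((α ^ (sgn k * i) : ℂˣ) : ℂ) * ξ * z (sgn k * i)) ∧
          (tuple₂ y k a α ξ * tuple₂ z l c β ζ :
              Multiplicative CInf ⋊[θ₃]
                ((Multiplicative ℂ ⋊[θ₁] (ℂˣ × ℂˣ)) ⋊[θ₂] Multiplicative (ZMod 2))) =
            tuple₂ w (k + l) (sgn l * a + ξ * c) (α ^ sgn l * β) (ξ * ζ)) ∧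
      (∀ (y : CInf) (k : ZMod 2) (a : ℂ) (α ξ : ℂˣ),
        ∃ ρ : AutWX .A ((0 : ℂ) : OnePoint ℂ),
          IsExpAd (vSum .A ((0 : ℂ) : OnePoint ℂ) y) ρ ∧
          e (tuple₂ y k a α ξ) = ρ * PsiAut ((0 : ℂ) : OnePoint ℂ) k a α ξ) ∧
      (SemidirectProduct.inl.range).map e.toMonoidHom =
        innAut (WX .A ((0 : ℂ) : OnePoint ℂ))) ∧
    (∃ (θ₁ : ℂˣ × ℂˣ →* MulAut (Multiplicative ℂ))
      (θ₂ : Multiplicative (ZMod 2) →* MulAut (Multiplicative ℂ ⋊[θ₁] (ℂˣ × ℂˣ)))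
      (θ₃ : ((Multiplicative ℂ ⋊[θ₁] (ℂˣ × ℂˣ)) ⋊[θ₂] Multiplicative (ZMod 2)) →*
        MulAut (Multiplicative CInf))
      (e : (Multiplicative CInf ⋊[θ₃]
          ((Multiplicative ℂ ⋊[θ₁] (ℂˣ × ℂˣ)) ⋊[θ₂] Multiplicative (ZMod 2))) ≃*
        AutWX .A ((-1 : ℂ) : OnePoint ℂ)),
      (∀ (y z : CInf) (k l : ZMod 2) (b d : ℂ) (α β ξ ζ : ℂˣ),
        ∃ w : CInf,
          (∀ i : ℤ, w i = y i +
            (if i = 0 then (sgn k : ℂ) else 1) * ((α ^ (sgn k * i) : ℂˣ) : ℂ) * ξ * z (sgn k * i)) ∧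
          (tuple₂ y k b α ξ * tuple₂ z l d β ζ :
              Multiplicative CInf ⋊[θ₃]
                ((Multiplicative ℂ ⋊[θ₁] (ℂˣ × ℂˣ)) ⋊[θ₂] Multiplicative (ZMod 2))) =
            tuple₂ w (k + l) (b + ξ * d) (α ^ sgn l * β) (ξ * ζ)) ∧
      (∀ (y : CInf) (k : ZMod 2) (b : ℂ) (α ξ : ℂˣ),
        ∃ ρ : AutWX .A ((-1 : ℂ) : OnePoint ℂ),
          IsExpAd (vSum .A ((-1 : ℂ) : OnePoint ℂ) y) ρ ∧
          e (tuple₂ y k b α ξ) = ρ * PsiAut ((-1 : ℂ) : OnePoint ℂ) k b α ξ) ∧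
      (SemidirectProduct.inl.range).map e.toMonoidHom =
        innAut (WX .A ((-1 : ℂ) : OnePoint ℂ))) ∧
    (∃ (θ₁ : ℂˣ × ℂˣ →* MulAut (Multiplicative (ℂ × ℂ)))
      (θ₂ : Multiplicative (ZMod 2) →* MulAut (Multiplicative (ℂ × ℂ) ⋊[θ₁] (ℂˣ × ℂˣ)))
      (θ₃ : ((Multiplicative (ℂ × ℂ) ⋊[θ₁] (ℂˣ × ℂˣ)) ⋊[θ₂] Multiplicative (ZMod 2)) →*
        MulAut (Multiplicative CInfZero))
      (e : (Multiplicative CInfZero ⋊[θ₃]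
          ((Multiplicative (ℂ × ℂ) ⋊[θ₁] (ℂˣ × ℂˣ)) ⋊[θ₂] Multiplicative (ZMod 2))) ≃*
        AutWX .B ((0 : ℂ) : OnePoint ℂ)),
      (∀ (y z : CInfZero) (k l : ZMod 2) (a b c d : ℂ) (α β ξ ζ : ℂˣ),
        ∃ w : CInfZero,
          (∀ i : ℤ, (w : CInf) i = (y : CInf) i +
            ((α ^ (sgn k * i) : ℂˣ) : ℂ) * ξ * (z : CInf) (sgn k * i)) ∧
          (tuple₂ y k (a, b) α ξ * tuple₂ z l (c, d) β ζ :
              Multiplicative CInfZero ⋊[θ₃]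
                ((Multiplicative (ℂ × ℂ) ⋊[θ₁] (ℂˣ × ℂˣ)) ⋊[θ₂] Multiplicative (ZMod 2))) =
            tuple₂ w (k + l) (sgn l * a + ξ * c, b + ξ * d) (α ^ sgn l * β) (ξ * ζ)) ∧
      (∀ (y : CInfZero) (k : ZMod 2) (a b : ℂ) (α ξ : ℂˣ),
        ∃ ρ : AutWX .B ((0 : ℂ) : OnePoint ℂ),
          IsExpAd (vSum .B ((0 : ℂ) : OnePoint ℂ) y) ρ ∧
          e (tuple₂ y k (a, b) α ξ) = ρ * PhiAut .B ((0 : ℂ) : OnePoint ℂ) k a b α ξ) ∧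
      (SemidirectProduct.inl.range).map e.toMonoidHom =
        innAut (WX .B ((0 : ℂ) : OnePoint ℂ))) ∧
    (∃ (θ₁ : ℂˣ × ℂˣ →* MulAut (Multiplicative ℂ))
      (θ₂ : Multiplicative (ZMod 2) →* MulAut (Multiplicative ℂ ⋊[θ₁] (ℂˣ × ℂˣ)))
      (θ₃ : ((Multiplicative ℂ ⋊[θ₁] (ℂˣ × ℂˣ)) ⋊[θ₂] Multiplicative (ZMod 2)) →*
        MulAut (Multiplicative CInfZero))
      (e : (Multiplicative CInfZero ⋊[θ₃]
          ((Multiplicative ℂ ⋊[θ₁] (ℂˣ × ℂˣ)) ⋊[θ₂] Multiplicative (ZMod 2))) ≃*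
        AutWX .B ((-1 : ℂ) : OnePoint ℂ)),
      (∀ (y z : CInfZero) (k l : ZMod 2) (a c : ℂ) (α β ξ ζ : ℂˣ),
        ∃ w : CInfZero,
          (∀ i : ℤ, (w : CInf) i = (y : CInf) i +
            ((α ^ (sgn k * i) : ℂˣ) : ℂ) * ξ * (z : CInf) (sgn k * i)) ∧
          (tuple₂ y k a α ξ * tuple₂ z l c β ζ :
              Multiplicative CInfZero ⋊[θ₃]
                ((Multiplicative ℂ ⋊[θ₁] (ℂˣ × ℂˣ)) ⋊[θ₂] Multiplicative (ZMod 2))) =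
            tuple₂ w (k + l) (sgn l * a + ξ * c) (α ^ sgn l * β) (ξ * ζ)) ∧
      (∀ (y : CInfZero) (k : ZMod 2) (a : ℂ) (α ξ : ℂˣ),
        ∃ ρ : AutWX .B ((-1 : ℂ) : OnePoint ℂ),
          IsExpAd (vSum .B ((-1 : ℂ) : OnePoint ℂ) y) ρ ∧
          e (tuple₂ y k a α ξ) = ρ * PhiAut .B ((-1 : ℂ) : OnePoint ℂ) k a 0 α ξ) ∧
      (SemidirectProduct.inl.range).map e.toMonoidHom =
        innAut (WX .B ((-1 : ℂ) : OnePoint ℂ))) ∧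
    (∀ lam : OnePoint ℂ, lam ≠ ((0 : ℂ) : OnePoint ℂ) → lam ≠ ((-1 : ℂ) : OnePoint ℂ) →
      ∃ (θ₁ : ℂˣ × ℂˣ →* MulAut (Multiplicative ℂ))
      (θ₂ : (Multiplicative ℂ ⋊[θ₁] (ℂˣ × ℂˣ)) →* MulAut (Multiplicative CInf))
      (e : (Multiplicative CInf ⋊[θ₂] (Multiplicative ℂ ⋊[θ₁] (ℂˣ × ℂˣ))) ≃* AutWX .A lam),
      (∀ (y z : CInf) (a c : ℂ) (α β ξ ζ : ℂˣ),
        ∃ w : CInf,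
          (∀ i : ℤ, w i = y i + ((α ^ i : ℂˣ) : ℂ) * ξ * z i) ∧
          (tuple y a α ξ * tuple z c β ζ :
              Multiplicative CInf ⋊[θ₂] (Multiplicative ℂ ⋊[θ₁] (ℂˣ × ℂˣ))) =
            tuple w (a + ξ * c) (α * β) (ξ * ζ)) ∧
      (∀ (y : CInf) (a : ℂ) (α ξ : ℂˣ),
        ∃ ρ : AutWX .A lam, IsExpAd (vSum .A lam y) ρ ∧
          e (tuple y a α ξ) = ρ * PsiAut lam 0 a α ξ) ∧
      (SemidirectProduct.inl.range).map e.toMonoidHom = innAut (WX .A lam)) ∧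
    (∀ lam : OnePoint ℂ, lam ≠ ((0 : ℂ) : OnePoint ℂ) → lam ≠ ((-1 : ℂ) : OnePoint ℂ) →
      ∃ (θ₁ : ℂˣ × ℂˣ →* MulAut (Multiplicative ℂ))
      (θ₂ : (Multiplicative ℂ ⋊[θ₁] (ℂˣ × ℂˣ)) →* MulAut (Multiplicative CInfZero))
      (e : (Multiplicative CInfZero ⋊[θ₂] (Multiplicative ℂ ⋊[θ₁] (ℂˣ × ℂˣ))) ≃* AutWX .B lam),
      (∀ (y z : CInfZero) (a c : ℂ) (α β ξ ζ : ℂˣ),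
        ∃ w : CInfZero,
          (∀ i : ℤ, (w : CInf) i = (y : CInf) i + ((α ^ i : ℂˣ) : ℂ) * ξ * (z : CInf) i) ∧
          (tuple y a α ξ * tuple z c β ζ :
              Multiplicative CInfZero ⋊[θ₂] (Multiplicative ℂ ⋊[θ₁] (ℂˣ × ℂˣ))) =
            tuple w (a + ξ * c) (α * β) (ξ * ζ)) ∧
      (∀ (y : CInfZero) (a : ℂ) (α ξ : ℂˣ),
        ∃ ρ : AutWX .B lam, IsExpAd (vSum .B lam y) ρ ∧
          e (tuple y a α ξ) = ρ * PhiAut .B lam 0 a 0 α ξ) ∧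
      (SemidirectProduct.inl.range).map e.toMonoidHom = innAut (WX .B lam)) := by
  refine ⟨fun X lam => ⟨innAut_normal X lam, exists_complement X lam⟩, ?_, ?_, ?_, ?_,
    fun lam h0 h1 => ?_, fun lam h0 h1 => ?_⟩
  · obtain ⟨-, θ, e, hmul, he, hmap⟩ :=
      outerA0.special (Or.inl rfl) (fun v => neg_neg v) intertwines_A0
        (j := AddMonoidHom.id CInf) Function.injective_id isReduced_A
    refine ⟨_, _, θ, e, fun y z k l a c α β ξ ζ => ?_, fun y k a α ξ => ?_, hmap⟩
    · obtain ⟨w, hw, h⟩ := hmul y z k l a c α β ξ ζ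
      refine ⟨w, fun i => ?_, ?_⟩
      · have h2 := hw i
        rw [tauCoeff_zero_lam, ite_self, one_mul] at h2
        exact h2
      · rwa [involPow_neg_id, smul_eq_mul] at h
    · obtain ⟨ρ, hρ, h⟩ := he y k a α ξ
      exact ⟨ρ, hρ, by rw [h, PsiAut, varpiAut_zero]⟩
  · obtain ⟨-, θ, e, hmul, he, hmap⟩ :=
      (outerA neg_one_ne_zero_onePoint).special (Or.inr rfl) (fun _ => rfl) intertwines_A
        (j := AddMonoidHom.id CInf) Function.injective_id isReduced_A
    refine ⟨_, _, θ, e, fun y z k l a c α β ξ ζ => ?_, fun y k a α ξ => ?_, hmap⟩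
    · obtain ⟨w, hw, h⟩ := hmul y z k l a c α β ξ ζ
      refine ⟨w, fun i => ?_, ?_⟩
      · have h2 := hw i
        have h3 : (if k = 0 then (1 : ℂ) else tauCoeff ((-1 : ℂ) : OnePoint ℂ) i) =
            if i = 0 then (sgn k : ℂ) else 1 := by
          rw [tauCoeff_neg_one_lam, sgn]
          split_ifs <;> simp
        rw [h3] at h2
        exact h2
      · rwa [involPow_id, smul_eq_mul] at h
    · obtain ⟨ρ, hρ, h⟩ := he y k a α ξ
      exact ⟨ρ, hρ, by rw [h, PsiAut, varpiAut_of_ne neg_one_ne_zero_onePoint]⟩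
  · obtain ⟨-, θ, e, hmul, he, hmap⟩ :=
      outerB0.special (Or.inl rfl) (fun v => Prod.ext (neg_neg v.1) rfl) intertwines_B0
        (j := CInfZero.subtype) Subtype.val_injective isReduced_B
    refine ⟨_, _, θ, e, fun y z k l a b c d α β ξ ζ => ?_, fun y k a b α ξ => ?_, hmap⟩
    · obtain ⟨w, hw, h⟩ := hmul y z k l (a, b) (c, d) α β ξ ζ
      refine ⟨w, fun i => ?_, ?_⟩
      · have h2 := hw i
        rw [tauCoeff_zero_lam, ite_self, one_mul] at h2
        exact h2
      · rw [involPow_prodMap] at h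
        exact h
    · obtain ⟨ρ, hρ, h⟩ := he y k (a, b) α ξ
      exact ⟨ρ, hρ, by rw [h, PhiAut, mul_assoc (tauAut _ _ ^ _) (phiAut _ _ _),
        phiAut_mul_psiAut_zero]⟩
  · obtain ⟨-, θ, e, hmul, he, hmap⟩ :=
      (outerB neg_one_ne_zero_onePoint).special (Or.inr rfl) (fun v => neg_neg v) intertwines_B
        (j := CInfZero.subtype) Subtype.val_injective isReduced_B
    refine ⟨_, _, θ, e, fun y z k l a c α β ξ ζ => ?_, fun y k a α ξ => ?_, hmap⟩
    · obtain ⟨w, hw, h⟩ := hmul y z k l a c α β ξ ζ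
      refine ⟨w, fun i => ?_, ?_⟩
      · have h2 := hw i
        -- For `λ = -1` the sign of `τ_λ` at index `0` would enter, but on `B` all coordinates at
        -- `0` vanish.
        rcases eq_or_ne i 0 with rfl | hi
        · have hz : (z : CInf) 0 = 0 := z.2
          have hw0 : (w : CInf) 0 = 0 := w.2
          have hy0 : (y : CInf) 0 = 0 := y.2
          rw [mul_zero, hz, hw0, hy0, mul_zero, add_zero]
        · rw [tauCoeff_neg_one_lam, if_neg hi, ite_self, one_mul] at h2
          exact h2
      · rwa [involPow_neg_id, smul_eq_mul] at h
    · obtain ⟨ρ, hρ, h⟩ := he y k a α ξ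
      exact ⟨ρ, hρ, by rw [h, PhiAut, mul_assoc (tauAut _ _ ^ _) (phiAut _ _ _),
        phiAut_mul_psiAut_of_ne neg_one_ne_zero_onePoint]⟩
  · obtain ⟨-, θ, e, hmul, he, hmap⟩ := (outerA h0).generic (not_or.2 ⟨h0, h1⟩)
      (j := AddMonoidHom.id CInf) Function.injective_id isReduced_A
    refine ⟨_, θ, e, fun y z a c α β ξ ζ => hmul y z a c α β ξ ζ, fun y a α ξ => ?_, hmap⟩
    obtain ⟨ρ, hρ, h⟩ := he y a α ξ
    exact ⟨ρ, hρ, by rw [h, PsiAut, varpiAut_of_ne h0, ZMod.val_zero, pow_zero, one_mul]⟩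
  · obtain ⟨-, θ, e, hmul, he, hmap⟩ := (outerB h0).generic (not_or.2 ⟨h0, h1⟩)
      (j := CInfZero.subtype) Subtype.val_injective isReduced_B
    refine ⟨_, θ, e, fun y z a c α β ξ ζ => hmul y z a c α β ξ ζ, fun y a α ξ => ?_, hmap⟩
    obtain ⟨ρ, hρ, h⟩ := he y a α ξ
    exact ⟨ρ, hρ, by rw [h, PhiAut, mul_assoc (tauAut _ _ ^ _) (phiAut _ _ _),
        phiAut_mul_psiAut_of_ne h0,
      ZMod.val_zero, pow_zero, one_mul]⟩
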